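/- \textbf{Setting.} ZX-diagrams $k\to l$ are the diagrams generated, by finite sequential and parallel composition, from the green spiders $Z^{(n,m)}_\alpha$ and red spiders $X^{(n,m)}_\alpha$ ($n$ inputs, $m$ outputs, phase $\alpha$ taken modulo $2\pi$), the triangle $T:1\to1$, wires, the cup $2\to0$, the cap $0\to2$, the swap $\sigma:2\to2$ and the empty diagram. Their standard interpretation as matrices is given by $Z^{(n,m)}_\alpha\mapsto|0\rangle^{\otimes m}\langle0|^{\otimes n}+e^{i\alpha}|1\rangle^{\otimes m}\langle1|^{\otimes n}$, $X^{(n,m)}_\alpha\mapsto|+\rangle^{\otimes m}\langle+|^{\otimes n}+e^{i\alpha}|-\rangle^{\otimes m}\langle-|^{\otimes n}$, $T\mapsto\begin{pmatrix}1&1\\0&1\end{pmatrix}$, and the usual maps for wires, cup, cap, swap and the empty diagram. Diagrams are read as morphisms of a symmetric compact closed category, and the order of the inputs and of the outputs of a spider is irrelevant. Below, $f;g$ means first $f$, then $g$. Write $\mathrm{COPY}=Z^{(1,2)}_0$, $\mathrm{XOR}=X^{(2,1)}_0$, $T^{t}$ for the transpose of $T$ (obtained by bending its wires with cup and cap), $T^{-1}:=Z^{(1,1)}_\pi;T;Z^{(1,1)}_\pi$,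 and $\mathrm{AND}_k:=T^{\otimes k};Z^{(k,1)}_0;T^{-1}$. Two diagrams are \emph{derivably equal} if they are related by the least congruence that contains the equations of a symmetric compact closed category (objects the natural numbers, with addition as tensor product), the irrelevance of the order of spider legs, the identification of every diagram $0\to0$ of non-zero interpretation with the empty diagram (non-zero scalars are ignored), and the following rules. \begin{itemize} \item Stabiliser rules, each also with the two colours exchanged, with $\kappa\in\{0,\pi\}$: (S1) two spiders of one colour joined by at least one wire fuse and their phases add; (S2) $Z^{(1,1)}_0$ is the wire; (S3) $Z^{(0,2)}_0$ is the cap and $Z^{(2,0)}_0$ the cup; (B1) $X^{(0,1)}_\kappa;Z^{(1,0)}_0$ is the empty diagram; (B2) $X^{(0,1)}_\kappa;Z^{(1,2)}_0=X^{(0,1)}_\kappa\otimes X^{(0,1)}_\kappa$; (B3) $X^{(2,1)}_0;Z^{(1,2)}_0=(Z^{(1,2)}_0\otimes Z^{(1,2)}_0);(1\otimes\sigma\otimes1);(X^{(2,1)}_0\otimes X^{(2,1)}_0)$. \item Triangle rules: (T1) $X^{(0,1)}_0;T=X^{(0,1)}_0$; (T2) $X^{(0,1)}_\pi;T=Z^{(0,1)}_0$;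 (T3) $T;T^{-1}$ is the wire; (T4) $X^{(1,1)}_\pi;T;X^{(1,1)}_\pi=T^{t}$. \item AND rules: (A1) $(p\oplus q)\cdot r=(p\cdot r)\oplus(q\cdot r)$ and (A2) $p\cdot p=p$, written as equations of diagrams with $\mathrm{COPY}$, $\mathrm{XOR}$, $\mathrm{AND}_2$; (A3) $\mathrm{AND}_2;\mathrm{COPY}=(\mathrm{COPY}\otimes\mathrm{COPY});(1\otimes\sigma\otimes1);(\mathrm{AND}_2\otimes\mathrm{AND}_2)$. \item Small-gadget rule, for $\alpha\in[0,2\pi)$: the equation of the theorem below for $n=3$. \end{itemize} On $n$ parallel lines, the \emph{phase gadget} of phase $\theta$ is obtained by putting a green copy spider $Z^{(1,2)}_0$ on every line, joining the new legs by the red spider $X^{(n,1)}_0$, and plugging $Z^{(1,0)}_\theta$ into its output. For a set $S$ of $k$ of the lines, the \emph{$k$-AND gate on $S$ plugged with the phase $\theta$} is obtained by putting a green copy spider on each line of $S$, joining the new legs by $\mathrm{AND}_k$, and plugging $Z^{(1,0)}_\theta$ into its output. \textbf{Theorem 1.} Let $\alpha$ be any angle (a real number) and $n\ge2$. Then the diagram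 on $n$ lines that consists of a green phase $Z^{(1,1)}_{\alpha/2}$ on each line followed by the phase gadget of phase $-\alpha/2$ on all $n$ lines is derivably equal to the sequential composite, in any order, of the following gates: for each $k\in\{2,\dots,n\}$ and each set $S$ of $k$ of the lines, exactly one $k$-AND gate on $S$, plugged with the phase $$\alpha_k=(-1)^k\,2^{k-2}\,\alpha .$$ -/

import Mathlib

noncomputable section

namespace ZXCalc

/-- The two colours of spiders: green (the `Z` spiders) and red (the `X` spiders). -/
inductive Color where
  | green
  | red

/-- The other colour. -/
def Color.other : Color → Color
  | .green => .red
  | .red => .green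

/-- `ZX n m` is the type of ZX-diagrams with `n` inputs and `m` outputs, generated by the elementary
diagrams under sequential and parallel composition.  Phases are angles, that is, reals modulo `2π`.
`id n` consists of `n` parallel wires (`id 1` is the wire, `id 0` the empty diagram), and
`braid a b` lets a bundle of `a` wires cross a bundle of `b` wires (`braid 1 1` is the swap `σ`). -/
inductive ZX : ℕ → ℕ → Type
  | spider (c : Color) (α : Real.Angle) (n m : ℕ) : ZX n m
  | triangle : ZX 1 1
  | cup : ZX 2 0
  | cap : ZX 0 2
  | id (n : ℕ) : ZX n n
  | braid (a b : ℕ) : ZX (a + b) (b + a)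
  | seq {l m n : ℕ} (f : ZX l m) (g : ZX m n) : ZX l n
  | tensor {a b c d : ℕ} (f : ZX a b) (g : ZX c d) : ZX (a + c) (b + d)

/-- Sequential composition in diagrammatic order: first `f`, then `g`. -/
infixl:65 " ⨟ " => ZX.seq

/-- Parallel composition. -/
infixl:75 " ⊠ " => ZX.tensor

namespace ZX

/-- The standard interpretation as a matrix (rows: basis states of the outputs, columns: basis
states of the inputs). -/
def interp : {n m : ℕ} → ZX n m → Matrix (Fin m → Fin 2) (Fin n → Fin 2) ℂ
  | _, _, spider .green α _ _ => fun o i =>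
      (if (∀ k, o k = 0) ∧ (∀ k, i k = 0) then 1 else 0) +
        (if (∀ k, o k = 1) ∧ (∀ k, i k = 1) then (α.toCircle : ℂ) else 0)
  | _, _, spider .red α n m => fun o i =>
      (((Real.sqrt 2)⁻¹ : ℝ) : ℂ) ^ (n + m) *
        (1 + (α.toCircle : ℂ) * (-1) ^ ((∑ k, (o k : ℕ)) + ∑ k, (i k : ℕ)))
  | _, _, triangle => fun o i => if o 0 = 1 ∧ i 0 = 0 then 0 else 1
  | _, _, cup => fun _ i => if i 0 = i 1 then 1 else 0
  | _, _, cap => fun o _ => if o 0 = o 1 then 1 else 0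
  | _, _, id _ => 1
  | _, _, braid a b => fun o i =>
      if (∀ k : Fin a, o (Fin.natAdd b k) = i (Fin.castAdd b k)) ∧
        (∀ k : Fin b, o (Fin.castAdd a k) = i (Fin.natAdd a k)) then 1 else 0
  | _, _, seq f g => interp g * interp f
  | _, _, @tensor a b c d f g => fun o i =>
      interp f (fun k => o (Fin.castAdd d k)) (fun k => i (Fin.castAdd c k)) *
        interp g (fun k => o (Fin.natAdd b k)) (fun k => i (Fin.natAdd a k))

/-- The identity diagram between two propositionally equal numbers of wires. -/
def wire {n m : ℕ} (h : n = m) : ZX n m := h ▸ id n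

/-- The `Z` spider (green). -/
abbrev Z (α : Real.Angle) (n m : ℕ) : ZX n m := spider .green α n m

/-- The `X` spider (red). -/
abbrev X (α : Real.Angle) (n m : ℕ) : ZX n m := spider .red α n m

/-- The angle `π`. -/
abbrev piAngle : Real.Angle := ((Real.pi : ℝ) : Real.Angle)

/-- The swap of two wires. -/
abbrev σ : ZX 2 2 := braid 1 1

/-- The transpose of the triangle. -/
def triangleT : ZX 1 1 :=
  (id 1 ⊠ cap : ZX 1 3) ⨟ (id 1 ⊠ triangle ⊠ id 1 : ZX 3 3) ⨟ (cup ⊠ id 1 : ZX 3 1)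

/-- The inverse triangle: the triangle between two green `π` phases. -/
def triangleInv : ZX 1 1 := Z piAngle 1 1 ⨟ triangle ⨟ Z piAngle 1 1

/-- `k` parallel copies of a one-wire diagram. -/
def power (f : ZX 1 1) : (k : ℕ) → ZX k k
  | 0 => id 0
  | k + 1 => power f k ⊠ f

/-- The `k`-input AND gate: a triangle on each input, merged by a green spider whose output carries
an inverse triangle. -/
def andGate (k : ℕ) : ZX k 1 := power triangle k ⨟ Z 0 k 1 ⨟ triangleInv

/-- The classical copy. -/
abbrev copy : ZX 1 2 := Z 0 1 2

/-- The classical XOR. -/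
abbrev xor : ZX 2 1 := X 0 2 1

/-- Put a green copy spider on line `i` and lead the new leg to the far right, across the
lines to the right of `i`. -/
def tap : {n : ℕ} → Fin n → ZX n (n + 1)
  | 0, i => i.elim0
  | n + 1, i =>
      Fin.lastCases (motive := fun _ => ZX (n + 1) (n + 1 + 1))
        (id n ⊠ copy :) (fun j => (tap j ⊠ id 1 :) ⨟ (id n ⊠ σ :)) i

/-- Tap each of the lines in the list `l` in turn. -/
def taps {n : ℕ} : (l : List (Fin n)) → ZX n (n + l.length)
  | [] => id n
  | i :: l => tap i ⨟ (taps l ⊠ id 1 :)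

/-- On `n` lines, connect the diagram `E` (which has no outputs) to the lines in `l` through
green copy spiders; the other lines are plain wires. -/
def attach {n : ℕ} (l : List (Fin n)) (E : ZX l.length 0) : ZX n n :=
  taps l ⨟ (id n ⊠ E)

/-- The phase gadget of phase `θ` on all `n` lines: a red spider joined to every line,
with a green phase `θ` plugged into its remaining leg. -/
def phaseGadget (n : ℕ) (θ : Real.Angle) : ZX n n :=
  attach (List.finRange n) (X 0 (List.finRange n).length 1 ⨟ Z θ 1 0)

/-- The AND gate on the lines in `S`, plugged with the phase `θ`. -/
def andPhase {n : ℕ} (S : Finset (Fin n)) (θ : Real.Angle) : ZX n n :=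
  attach (S.sort (· ≤ ·)) (andGate (S.sort (· ≤ ·)).length ⨟ Z θ 1 0)

/-- A one-line green phase `θ` on each of the `n` lines. -/
def linePhases (n : ℕ) (θ : Real.Angle) : ZX n n := power (Z θ 1 1) n

/-- Sequential composition of a list of diagrams on `n` lines. -/
def seqList {n : ℕ} : List (ZX n n) → ZX n n
  | [] => id n
  | f :: L => f ⨟ seqList L

end ZX

open ZX in
/-- Derivable equality of ZX-diagrams: the least congruence that contains the equations of a
symmetric, (self-dual) compact closed strict monoidal category, the identification of diagrams that
differ by a non-zero scalar, and the rules. -/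
inductive Derivable : {n m : ℕ} → ZX n m → ZX n m → Prop
  -- congruence
  | refl {n m : ℕ} (f : ZX n m) : Derivable f f
  | symm {n m : ℕ} {f g : ZX n m} : Derivable f g → Derivable g f
  | trans {n m : ℕ} {f g h : ZX n m} : Derivable f g → Derivable g h → Derivable f h
  | seq_congr {l m n : ℕ} {f f' : ZX l m} {g g' : ZX m n} :
      Derivable f f' → Derivable g g' → Derivable (f ⨟ g) (f' ⨟ g')
  | tensor_congr {a b c d : ℕ} {f f' : ZX a b} {g g' : ZX c d} :
      Derivable f f' → Derivable g g' → Derivable (f ⊠ g) (f' ⊠ g')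
  -- category
  | id_seq {n m : ℕ} (f : ZX n m) : Derivable (id n ⨟ f) f
  | seq_id {n m : ℕ} (f : ZX n m) : Derivable (f ⨟ id m) f
  | seq_assoc {k l m n : ℕ} (f : ZX k l) (g : ZX l m) (h : ZX m n) :
      Derivable (f ⨟ g ⨟ h) (f ⨟ (g ⨟ h))
  -- strict monoidal structure
  | id_tensor_id (a b : ℕ) : Derivable (id a ⊠ id b) (id (a + b))
  | interchange {a b c a' b' c' : ℕ} (f : ZX a b) (g : ZX b c) (f' : ZX a' b') (g' : ZX b' c') :
      Derivable ((f ⨟ g) ⊠ (f' ⨟ g')) ((f ⊠ f') ⨟ (g ⊠ g'))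
  | tensor_assoc {a b c d e e' : ℕ} (f : ZX a b) (g : ZX c d) (h : ZX e e') :
      Derivable ((f ⊠ g ⊠ h) ⨟ wire (Nat.add_assoc b d e'))
        (wire (Nat.add_assoc a c e) ⨟ (f ⊠ (g ⊠ h)))
  | empty_tensor {n m : ℕ} (f : ZX n m) :
      Derivable ((id 0 ⊠ f) ⨟ wire (Nat.zero_add m)) (wire (Nat.zero_add n) ⨟ f)
  | tensor_empty {n m : ℕ} (f : ZX n m) : Derivable (f ⊠ id 0) f
  -- symmetry
  | braid_natural {a b c d : ℕ} (f : ZX a b) (g : ZX c d) :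
      Derivable ((f ⊠ g) ⨟ braid b d) (braid a c ⨟ (g ⊠ f))
  | braid_braid (a b : ℕ) : Derivable (braid a b ⨟ braid b a) (id (a + b))
  | hexagon (a b c : ℕ) :
      Derivable (braid (a + b) c)
        (wire (Nat.add_assoc a b c) ⨟ (id a ⊠ braid b c) ⨟ wire (Nat.add_assoc a c b).symm ⨟
          (braid a c ⊠ id b) ⨟ wire (Nat.add_assoc c a b))
  -- compact structure
  | snake : Derivable ((cap ⊠ id 1 : ZX 1 3) ⨟ (id 1 ⊠ cup : ZX 3 1)) (id 1)
  | snake' : Derivable ((id 1 ⊠ cap : ZX 1 3) ⨟ (cup ⊠ id 1 : ZX 3 1)) (id 1)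
  | swap_cup : Derivable (σ ⨟ cup) cup
  | cap_swap : Derivable (cap ⨟ σ) cap
  -- spiders have unordered legs
  | swap_spider (c : Color) (α : Real.Angle) (p q m : ℕ) :
      Derivable ((id p ⊠ σ ⊠ id q) ⨟ spider c α (p + 2 + q) m) (spider c α (p + 2 + q) m)
  | spider_swap (c : Color) (α : Real.Angle) (n p q : ℕ) :
      Derivable (spider c α n (p + 2 + q) ⨟ (id p ⊠ σ ⊠ id q)) (spider c α n (p + 2 + q))
  -- non-zero scalars are ignored
  | scalar (s : ZX 0 0) : s.interp 0 0 ≠ 0 → Derivable s (id 0)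
  /- Stabiliser rules, in both colourings. -/
  -- spiders of one colour that are joined by at least one wire fuse, and their phases add up
  | S1 (c : Color) (α β : Real.Angle) (a b k d e : ℕ) :
      Derivable ((spider c α a (b + (k + 1)) ⊠ id d) ⨟ wire (Nat.add_assoc b (k + 1) d) ⨟
          (id b ⊠ spider c β (k + 1 + d) e))
        (spider c (α + β) (a + d) (b + e))
  | S2 (c : Color) : Derivable (spider c 0 1 1) (id 1)
  | S3 (c : Color) : Derivable (spider c 0 0 2) cap
  | S3' (c : Color) : Derivable (spider c 0 2 0) cup
  -- deletion and copying of basis states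
  | B1 (c : Color) (κ : Real.Angle) : κ = 0 ∨ κ = piAngle →
      Derivable (spider c κ 0 1 ⨟ spider c.other 0 1 0) (id 0)
  | B2 (c : Color) (κ : Real.Angle) : κ = 0 ∨ κ = piAngle →
      Derivable (spider c κ 0 1 ⨟ spider c.other 0 1 2) (spider c κ 0 1 ⊠ spider c κ 0 1)
  -- bialgebra
  | B3 (c : Color) :
      Derivable (spider c 0 2 1 ⨟ spider c.other 0 1 2)
        ((spider c.other 0 1 2 ⊠ spider c.other 0 1 2) ⨟ (id 1 ⊠ σ ⊠ id 1 : ZX 4 4) ⨟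
          (spider c 0 2 1 ⊠ spider c 0 2 1))
  /- Triangle rules. -/
  | T1 : Derivable (X 0 0 1 ⨟ triangle) (X 0 0 1)
  | T2 : Derivable (X piAngle 0 1 ⨟ triangle) (Z 0 0 1)
  | T3 : Derivable (triangle ⨟ triangleInv) (id 1)
  | T4 : Derivable (X piAngle 1 1 ⨟ triangle ⨟ X piAngle 1 1) triangleT
  /- AND rules. -/
  -- `(p ⊕ q) · r = (p · r) ⊕ (q · r)`
  | A1 : Derivable ((xor ⊠ id 1 : ZX 3 2) ⨟ andGate 2)
      ((id 1 ⊠ id 1 ⊠ copy : ZX 3 4) ⨟ (id 1 ⊠ σ ⊠ id 1 : ZX 4 4) ⨟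
        (andGate 2 ⊠ andGate 2 : ZX 4 2) ⨟ xor)
  -- `p · p = p`
  | A2 : Derivable (copy ⨟ andGate 2) (id 1)
  -- the AND gate commutes with copying
  | A3 : Derivable (andGate 2 ⨟ copy)
      ((copy ⊠ copy : ZX 2 4) ⨟ (id 1 ⊠ σ ⊠ id 1 : ZX 4 4) ⨟ (andGate 2 ⊠ andGate 2 : ZX 4 2))
  /- The decomposition of the three-line phase gadget. -/
  | smallGadget (α : ℝ) : 0 ≤ α → α < 2 * Real.pi →
      Derivable (linePhases 3 ((α / 2 : ℝ) : Real.Angle) ⨟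
          phaseGadget 3 ((-α / 2 : ℝ) : Real.Angle))
        (andPhase {0, 1} (α : Real.Angle) ⨟ andPhase {0, 2} (α : Real.Angle) ⨟
          andPhase {1, 2} (α : Real.Angle) ⨟ andPhase {0, 1, 2} ((-2 * α : ℝ) : Real.Angle))

end ZXCalc

end

/-!
A green copy spider on each line makes a bundle of `n` wires a commutative comonoid, and this turns
the statement about gates into algebra.

Diagrams modulo derivable equality form a symmetric monoidal category `Wires`.  If `A` is a
commutative comonoid in it, the morphisms from `A` to a single wire that commute with copying and
discarding (`Point A`, the Boolean functions on `A`) form a commutative semiring under XOR and AND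
in which every element is idempotent; this is what the AND rules, the bialgebra rule and the
triangle rules say.  The morphisms from `A` to the unit object (`Effect A`) form a commutative
monoid, with copying as multiplication, and `Effect.box` embeds this monoid into the
endomorphisms of `A`.  A Boolean function `f` and a phase `θ` give the effect `f.kick θ`, additive
in `θ`.  Each gate of the theorem is the box of such an effect: with `xᵢ = proj i` the value of the
line `i`, the phase gadget is the box of `(∑ i, xᵢ).kick θ` (`phaseGadget_mk`) and the AND gate on
`S` that of `(∏ i ∈ S, xᵢ).kick θ` (`andPhase_mk`).  In particular the order of the gates is
irrelevant.

It remains to expand the phase of a sum.  Setting one line of the three-line gadget to `0` gives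
`f.kick (α / 2) * g.kick (α / 2) * (f + g).kick (-α / 2) = (f * g).kick α` (`kick_two`).  The rule
only covers `0 ≤ α < 2π`; for other `α` the half angles may change by `π`, which is harmless because
the phase `π` of an XOR is the product of the phases `π` of its arguments.  The theorem follows by
induction on the number of functions (`Point.kick_sum`): with `y = ∑ i, zᵢ`, the two-line rule
rewrites the phase of `z + y` through the phases of `z`, `y` and `z * y = ∑ i, z * zᵢ`, and the
induction hypothesis is used for `y` with `α` and for `z * y` with `-2α`.  By idempotence each
subset `S` contributes the function `z * ∏ i ∈ S, zᵢ` to the latter, with the phase that belongs to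
subsets of one more element.
-/

noncomputable section

open CategoryTheory MonoidalCategory

namespace ZXCalc

open ZX
open scoped ComonObj

/-! ### The symmetric monoidal category of diagrams modulo derivable equality -/

/-- The objects of the category of diagrams: bundles of parallel wires.  This is a structure rather
than `ℕ` itself, so that the tensor product does not interfere with the arithmetic of `ℕ`. -/
structure Wires where
  /-- The number of wires. -/
  count : ℕ

/-- Diagrams up to derivable equality. -/
instance derivableSetoid (n m : ℕ) : Setoid (ZX n m) where
  r := Derivable
  iseqv := ⟨Derivable.refl, Derivable.symm, Derivable.trans⟩

/-- The bundle of `n` wires.  It is not reducible: `wires (n + 1)` and `wires n ⊗ W` are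
definitionally equal, but instance search does not identify them. -/
def wires (n : ℕ) : Wires := ⟨n⟩

/-- Morphisms are diagrams modulo derivable equality. -/
instance : Category Wires where
  Hom A B := Quotient (derivableSetoid A.count B.count)
  id A := Quotient.mk _ (ZX.id A.count)
  comp := Quotient.map₂ ZX.seq fun _ _ h _ _ h' => Derivable.seq_congr h h'
  id_comp := by rintro _ _ ⟨f⟩; exact Quotient.sound (Derivable.id_seq f)
  comp_id := by rintro _ _ ⟨f⟩; exact Quotient.sound (Derivable.seq_id f)
  assoc := by rintro _ _ _ _ ⟨f⟩ ⟨g⟩ ⟨h⟩; exact Quotient.sound (Derivable.seq_assoc f g h)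

/-- The morphism represented by a diagram. -/
def ZX.mk {n m : ℕ} (f : ZX n m) : wires n ⟶ wires m := Quotient.mk (derivableSetoid n m) f

theorem ZX.mk_eq_mk {n m : ℕ} {f g : ZX n m} : f.mk = g.mk ↔ Derivable f g := Quotient.eq

theorem ZX.mk_seq {l m n : ℕ} (f : ZX l m) (g : ZX m n) : (f ⨟ g).mk = f.mk ≫ g.mk := rfl

/-- The identity between two propositionally equal bundles.  When the two numbers are definitionally
equal, this is the identity by `rfl`, so on explicit numbers of wires all associators and unitors
are identities. -/
def wireIso {n m : ℕ} (h : n = m) : wires n ≅ wires m := eqToIso (congrArg wires h)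

theorem ZX.mk_wire {n m : ℕ} (h : n = m) : (ZX.wire h).mk = (wireIso h).hom := by
  subst h; rfl

/-- The tensor product is juxtaposition of bundles; the coherence isomorphisms are `wireIso`. -/
instance : MonoidalCategoryStruct Wires where
  tensorObj A B := ⟨A.count + B.count⟩
  tensorUnit := ⟨0⟩
  tensorHom := Quotient.map₂ ZX.tensor fun _ _ h _ _ h' => Derivable.tensor_congr h h'
  whiskerLeft A _ _ f := Quotient.map₂ ZX.tensor
    (fun _ _ h _ _ h' => Derivable.tensor_congr h h') (Quotient.mk _ (ZX.id A.count)) f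
  whiskerRight f A := Quotient.map₂ ZX.tensor
    (fun _ _ h _ _ h' => Derivable.tensor_congr h h') f (Quotient.mk _ (ZX.id A.count))
  associator A B C := wireIso (Nat.add_assoc A.count B.count C.count)
  leftUnitor A := wireIso (Nat.zero_add A.count)
  rightUnitor A := wireIso (Nat.add_zero A.count)

theorem ZX.mk_tensor {a b c d : ℕ} (f : ZX a b) (g : ZX c d) : (f ⊠ g).mk = f.mk ⊗ₘ g.mk := rfl

theorem exists_mk {n m : ℕ} (f : wires n ⟶ wires m) : ∃ g : ZX n m, g.mk = f :=
  Quotient.exists_rep f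

theorem tensor_id (n m : ℕ) : 𝟙 (wires n) ⊗ₘ 𝟙 (wires m) = 𝟙 (wires (n + m)) :=
  Quotient.sound (Derivable.id_tensor_id n m)

theorem wireIso_trans {a b c : ℕ} (h : a = b) (h' : b = c) :
    (wireIso h).hom ≫ (wireIso h').hom = (wireIso (h.trans h')).hom := by
  subst h h'; exact Category.id_comp _

theorem wireIso_tensor {a b c d : ℕ} (h : a = b) (h' : c = d) :
    (wireIso h).hom ⊗ₘ (wireIso h').hom =
      (wireIso (congrArg₂ (· + ·) h h') : wires (a + c) ≅ wires (b + d)).hom := by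
  subst h h'; exact tensor_id _ _

instance : MonoidalCategory Wires := MonoidalCategory.ofTensorHom
  (id_tensorHom_id := fun A B => tensor_id A.count B.count)
  (id_tensorHom := by intros; rfl)
  (tensorHom_id := by intros; rfl)
  (tensorHom_comp_tensorHom := by
    rintro _ _ _ _ _ _ ⟨f⟩ ⟨g⟩ ⟨h⟩ ⟨k⟩
    exact Quotient.sound (Derivable.interchange f h g k).symm)
  (associator_naturality := by
    rintro ⟨a⟩ ⟨b⟩ ⟨c⟩ ⟨d⟩ ⟨e⟩ ⟨e'⟩ ⟨f⟩ ⟨g⟩ ⟨h⟩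
    have := ZX.mk_eq_mk.2 (Derivable.tensor_assoc f g h)
    rw [ZX.mk_seq, ZX.mk_seq, ZX.mk_wire, ZX.mk_wire] at this
    exact this)
  (leftUnitor_naturality := by
    rintro ⟨a⟩ ⟨b⟩ ⟨f⟩
    have := ZX.mk_eq_mk.2 (Derivable.empty_tensor f)
    rw [ZX.mk_seq, ZX.mk_seq, ZX.mk_wire, ZX.mk_wire] at this
    exact this)
  (rightUnitor_naturality := by
    rintro ⟨a⟩ ⟨b⟩ ⟨f⟩
    have := ZX.mk_eq_mk.2 (Derivable.tensor_empty f)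
    exact (Category.comp_id (ZX.mk (f ⊠ .id 0))).trans
      (this.trans (Category.id_comp (ZX.mk f)).symm))
  (pentagon := by
    rintro ⟨a⟩ ⟨b⟩ ⟨c⟩ ⟨d⟩
    refine Eq.trans (b := (wireIso (by omega : a + b + c + d = a + (b + (c + d)))).hom) ?_
      (wireIso_trans _ _).symm
    refine Eq.trans (congrArg₂ (fun f g => f ≫ (wireIso _).hom ≫ g)
      (wireIso_tensor (Nat.add_assoc a b c) (Eq.refl d))
      (wireIso_tensor (Eq.refl a) (Nat.add_assoc b c d))) ?_
    exact (congrArg _ (wireIso_trans _ _)).trans (wireIso_trans _ _))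
  (triangle := by
    rintro ⟨a⟩ ⟨b⟩
    refine Eq.trans (congrArg (fun f => (wireIso _).hom ≫ f)
      (wireIso_tensor (Eq.refl a) (Nat.zero_add b))) ?_
    exact (wireIso_trans _ _).trans (wireIso_tensor (Nat.add_zero a) (Eq.refl b)).symm)

/-- The crossing of two bundles of wires. -/
def braidIso (A B : Wires) : A ⊗ B ≅ B ⊗ A where
  hom := (ZX.braid A.count B.count).mk
  inv := (ZX.braid B.count A.count).mk
  hom_inv_id := Quotient.sound (Derivable.braid_braid A.count B.count)
  inv_hom_id := Quotient.sound (Derivable.braid_braid B.count A.count)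

theorem braidIso_natural {A B A' B' : Wires} (f : A ⟶ B) (g : A' ⟶ B') :
    (f ⊗ₘ g) ≫ (braidIso B B').hom = (braidIso A A').hom ≫ (g ⊗ₘ f) := by
  obtain ⟨f, rfl⟩ := exists_mk f
  obtain ⟨g, rfl⟩ := exists_mk g
  exact Quotient.sound (Derivable.braid_natural f g)

theorem braidIso_hexagon (A B C : Wires) :
    braidIso (A ⊗ B) C = α_ A B C ≪≫ whiskerLeftIso A (braidIso B C) ≪≫ (α_ A C B).symm ≪≫
      whiskerRightIso (braidIso A C) B ≪≫ α_ C A B := by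
  ext
  refine (ZX.mk_eq_mk.2 (Derivable.hexagon A.count B.count C.count)).trans ?_
  rw [ZX.mk_seq, ZX.mk_seq, ZX.mk_seq, ZX.mk_seq, ZX.mk_wire, ZX.mk_wire, ZX.mk_wire]
  simp only [Category.assoc]
  rfl

instance : SymmetricCategory Wires where
  braiding := braidIso
  braiding_naturality_right A _ _ f := by
    simpa using braidIso_natural (𝟙 A) f
  braiding_naturality_left f C := by
    simpa using braidIso_natural f (𝟙 C)
  hexagon_forward A B C := by
    -- the crossings of `A` with `B ⊗ C` and of `B ⊗ C` with `A` are inverse to each other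
    have h := congrArg Iso.inv (braidIso_hexagon B C A)
    have h' : (braidIso (B ⊗ C) A).inv = (braidIso A (B ⊗ C)).hom := rfl
    have h1 : (braidIso B A).inv = (braidIso A B).hom := rfl
    have h2 : (braidIso C A).inv = (braidIso A C).hom := rfl
    simp only [h', Iso.trans_inv, whiskerRightIso_inv, whiskerLeftIso_inv, h1, h2, Iso.symm_inv,
      Category.assoc] at h
    simp [h]
  hexagon_reverse A B C := by
    simp [braidIso_hexagon A B C]
  symmetry A B := (braidIso A B).hom_inv_id

/-! ### Pairing and effects for commutative comonoids -/

section Comonoid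

variable {C : Type*} [Category* C] [MonoidalCategory C] {A : C} [ComonObj A]

/-- Copy the input and apply `f` to one copy and `g` to the other. -/
def pair {X Y : C} (f : A ⟶ X) (g : A ⟶ Y) : A ⟶ X ⊗ Y := Δ ≫ (f ⊗ₘ g)

theorem pair_map {X Y X' Y' : C} (f : A ⟶ X) (g : A ⟶ Y) (h : X ⟶ X') (k : Y ⟶ Y') :
    pair f g ≫ (h ⊗ₘ k) = pair (f ≫ h) (g ≫ k) := by
  simp [pair]

theorem pair_whiskerRight {X Y X' : C} (f : A ⟶ X) (g : A ⟶ Y) (h : X ⟶ X') :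
    pair f g ≫ h ▷ Y = pair (f ≫ h) g := by
  rw [← tensorHom_id, pair_map, Category.comp_id]

theorem pair_whiskerLeft {X Y Y' : C} (f : A ⟶ X) (g : A ⟶ Y) (k : Y ⟶ Y') :
    pair f g ≫ X ◁ k = pair f (g ≫ k) := by
  rw [← id_tensorHom, pair_map, Category.comp_id]

theorem pair_associator {X Y Z : C} (f : A ⟶ X) (g : A ⟶ Y) (h : A ⟶ Z) :
    pair (pair f g) h ≫ (α_ X Y Z).hom = pair f (pair g h) := by
  have h1 : pair (pair f g) h = Δ ≫ Δ ▷ A ≫ ((f ⊗ₘ g) ⊗ₘ h) := by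
    rw [← tensorHom_id, tensorHom_comp_tensorHom, Category.id_comp]; rfl
  have h2 : pair f (pair g h) = Δ ≫ A ◁ Δ ≫ (f ⊗ₘ (g ⊗ₘ h)) := by
    rw [← id_tensorHom, tensorHom_comp_tensorHom, Category.id_comp]; rfl
  rw [h1, h2, ComonObj.comul_assoc_assoc, Category.assoc, Category.assoc, associator_naturality]

theorem pair_associator_inv {X Y Z : C} (f : A ⟶ X) (g : A ⟶ Y) (h : A ⟶ Z) :
    pair f (pair g h) ≫ (α_ X Y Z).inv = pair (pair f g) h := by
  rw [← pair_associator, Category.assoc, Iso.hom_inv_id, Category.comp_id]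

theorem pair_counit {X : C} (f : A ⟶ X) : pair f ε[A] ≫ (ρ_ X).hom = f := by
  simp [pair]

theorem counit_pair {X : C} (f : A ⟶ X) : pair ε[A] f ≫ (λ_ X).hom = f := by
  simp [pair]

theorem comp_pair {B X Y : C} [ComonObj B] (d : B ⟶ A) [IsComonHom d] (f : A ⟶ X) (g : A ⟶ Y) :
    d ≫ pair f g = pair (d ≫ f) (d ≫ g) := by
  simp [pair]

theorem pair_id_id : pair (𝟙 A) (𝟙 A) = Δ := by simp [pair]

variable {B : C} [ComonObj B]

/-- The projection to the first factor of a tensor product, which discards the second one. -/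
def fst (A B : C) [ComonObj B] : A ⊗ B ⟶ A := (𝟙 A ⊗ₘ ε[B]) ≫ (ρ_ A).hom

/-- The projection to the second factor of a tensor product, which discards the first one. -/
def snd (A B : C) [ComonObj A] : A ⊗ B ⟶ B := (ε[A] ⊗ₘ 𝟙 B) ≫ (λ_ B).hom

theorem pair_fst {X : C} (f : A ⟶ X) (g : A ⟶ B) [IsComonHom g] :
    pair f g ≫ fst X B = f := by
  rw [fst, ← Category.assoc, pair_map, IsComonHom.hom_counit, Category.comp_id, pair_counit]

theorem pair_snd {X : C} (f : A ⟶ B) (g : A ⟶ X) [IsComonHom f] :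
    pair f g ≫ snd B X = g := by
  rw [snd, ← Category.assoc, pair_map, IsComonHom.hom_counit, Category.comp_id, counit_pair]

/-- The convolution of `f` and `g`: copy the input, apply `f` and `g`, and combine the results with
`m`. -/
def conv {X : C} (m : X ⊗ X ⟶ X) (f g : A ⟶ X) : A ⟶ X := pair f g ≫ m

theorem conv_assoc {X : C} {m : X ⊗ X ⟶ X} (h : m ▷ X ≫ m = (α_ X X X).hom ≫ X ◁ m ≫ m)
    (f g k : A ⟶ X) : conv m (conv m f g) k = conv m f (conv m g k) := by
  rw [conv, conv, conv, conv, ← pair_whiskerRight, ← pair_whiskerLeft, ← pair_associator,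
    Category.assoc, Category.assoc, Category.assoc, h]

theorem conv_left {X : C} {m : X ⊗ X ⟶ X} {u : 𝟙_ C ⟶ X} {v : X ⟶ X}
    (h : u ▷ X ≫ m = (λ_ X).hom ≫ v) (f : A ⟶ X) : conv m (ε ≫ u) f = f ≫ v := by
  rw [conv, ← pair_whiskerRight, Category.assoc, h, ← Category.assoc, counit_pair]

theorem comp_conv {D X : C} [ComonObj D] (d : D ⟶ A) [IsComonHom d] (m : X ⊗ X ⟶ X)
    (f g : A ⟶ X) : d ≫ conv m f g = conv m (d ≫ f) (d ≫ g) := by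
  rw [conv, ← Category.assoc, comp_pair, conv]

variable (A) in
/-- The morphisms from a comonoid to the unit object.  A structure, so that the multiplication of
effects is kept apart from other operations on morphisms. -/
@[ext]
structure Effect where
  /-- The underlying morphism. -/
  hom : A ⟶ 𝟙_ C

/-- Keep one copy of the input and feed the other one to the effect `e`. -/
def Effect.box (e : Effect A) : A ⟶ A := pair (𝟙 A) e.hom ≫ (ρ_ A).hom

theorem Effect.box_comp {X : C} (e : Effect A) (f : A ⟶ X) :
    e.box ≫ f = pair f e.hom ≫ (ρ_ X).hom := by
  rw [Effect.box, Category.assoc, ← rightUnitor_naturality, ← Category.assoc, pair_whiskerRight,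
    Category.id_comp]

theorem Effect.box_counit (e : Effect A) : e.box ≫ ε[A] = e.hom := by
  rw [Effect.box_comp, ← unitors_equal, counit_pair]

/-- The box of an effect determines it: discarding the output gives the effect back. -/
theorem Effect.box_injective : Function.Injective (Effect.box (A := A)) := fun e f h => by
  ext
  rw [← e.box_counit, h, f.box_counit]

variable [SymmetricCategory C]

theorem pair_braiding [IsCommComonObj A] {X Y : C} (f : A ⟶ X) (g : A ⟶ Y) :
    pair f g ≫ (β_ X Y).hom = pair g f := by
  rw [pair, Category.assoc, BraidedCategory.braiding_naturality,
    IsCommComonObj.comul_comm_assoc, pair]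

/-- The middle-four interchange acts on nested pairs by exchanging the two middle entries. -/
theorem pair_tensorμ [IsCommComonObj A] {X Y Z W : C} (f : A ⟶ X) (g : A ⟶ Y) (h : A ⟶ Z)
    (k : A ⟶ W) : pair (pair f g) (pair h k) ≫ tensorμ X Y Z W = pair (pair f h) (pair g k) := by
  rw [tensorμ, ← Category.assoc, pair_associator, ← Category.assoc, pair_whiskerLeft,
    pair_associator_inv, ← Category.assoc, pair_whiskerLeft, pair_whiskerRight, pair_braiding,
    ← Category.assoc, pair_whiskerLeft, pair_associator, pair_associator_inv]

/-- On a tensor product of comonoids, pairing is done factor by factor. -/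
theorem pair_tensor {B X Y Z W : C} [ComonObj B] (f : A ⟶ X) (g : A ⟶ Z) (h : B ⟶ Y)
    (k : B ⟶ W) : pair (f ⊗ₘ h) (g ⊗ₘ k) = (pair f g ⊗ₘ pair h k) ≫ tensorμ X Z Y W := by
  simp only [pair, Comon.tensorObj_comul, Category.assoc]
  rw [← tensorμ_natural, tensorHom_comp_tensorHom_assoc]

instance isComonHom_tensor {B A' B' : C} [ComonObj B] [ComonObj A'] [ComonObj B'] (f : A ⟶ B)
    (g : A' ⟶ B') [IsComonHom f] [IsComonHom g] : IsComonHom (f ⊗ₘ g) :=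
  Comon.Hom.isComonHom_hom (tensorHom (C := Comon C) (X₁ := Comon.mk A) (Y₁ := Comon.mk B)
    (X₂ := Comon.mk A') (Y₂ := Comon.mk B') (Comon.Hom.mk f) (Comon.Hom.mk g))

/-- For a commutative comonoid, copying is itself a comonoid morphism. -/
instance isComonHom_comul [IsCommComonObj A] : IsComonHom Δ[A] where
  hom_counit := by
    rw [← pair_id_id, Comon.tensorObj_counit, ← Category.assoc, pair_map, Category.id_comp,
      unitors_equal, pair_counit]
  hom_comul := by
    rw [Comon.tensorObj_comul, ← Category.assoc]
    nth_rw 1 [← pair_id_id]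
    rw [pair_map, Category.id_comp]
    have h := pair_tensorμ (𝟙 A) (𝟙 A) (𝟙 A) (𝟙 A)
    rw [pair_id_id] at h
    exact h

instance isComonHom_pair [IsCommComonObj A] {B B' : C} [ComonObj B] [ComonObj B'] (f : A ⟶ B)
    (g : A ⟶ B') [IsComonHom f] [IsComonHom g] : IsComonHom (pair f g) :=
  inferInstanceAs (IsComonHom (Δ[A] ≫ (f ⊗ₘ g)))

section

attribute [local instance] ComonObj.instTensorUnit

instance isComonHom_counit : IsComonHom ε[A] :=
  Comon.Hom.isComonHom_hom (default : Comon.mk A ⟶ Comon.trivial C)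

instance isComonHom_leftUnitor : IsComonHom (λ_ A).hom where
  hom_counit := by simp
  hom_comul := by
    rw [Comon.tensorObj_comul, ComonObj.instTensorUnit_comul, ← leftUnitor_naturality,
      tensor_left_unitality, MonoidalCategory.tensorHom_def' (λ_ (𝟙_ C)).inv Δ]
    simp only [Category.assoc]

instance isComonHom_rightUnitor : IsComonHom (ρ_ A).hom where
  hom_counit := by simp [unitors_equal]
  hom_comul := by
    rw [Comon.tensorObj_comul, ComonObj.instTensorUnit_comul, ← rightUnitor_naturality,
      tensor_right_unitality, MonoidalCategory.tensorHom_def Δ (λ_ (𝟙_ C)).inv]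
    simp only [Category.assoc]

end

attribute [local instance] ComonObj.instTensorUnit in
instance isComonHom_fst : IsComonHom (fst A B) :=
  inferInstanceAs (IsComonHom ((𝟙 A ⊗ₘ ε[B]) ≫ (ρ_ A).hom))

attribute [local instance] ComonObj.instTensorUnit in
instance isComonHom_snd : IsComonHom (snd A B) :=
  inferInstanceAs (IsComonHom ((ε[A] ⊗ₘ 𝟙 B) ≫ (λ_ B).hom))

theorem conv_comm [IsCommComonObj A] {X : C} {m : X ⊗ X ⟶ X} (h : (β_ X X).hom ≫ m = m)
    (f g : A ⟶ X) : conv m f g = conv m g f := by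
  rw [conv, conv, ← pair_braiding f g, Category.assoc, h]

variable (A B) in
theorem pair_fst_snd : pair (fst A B) (snd A B) = 𝟙 (A ⊗ B) := by
  rw [fst, snd, ← pair_map, pair_tensor, ← Category.comp_id (pair (𝟙 A) ε),
    ← (ρ_ A).hom_inv_id]
  rw [← Category.assoc (pair (𝟙 A) ε), pair_counit]
  rw [← Category.comp_id (pair ε (𝟙 B)), ← (λ_ B).hom_inv_id,
    ← Category.assoc (pair ε (𝟙 B)), counit_pair]
  simp only [tensorμ, braiding_tensorUnit_left]
  monoidal

/-- Tapping the second factor of a tensor product amounts to copying it. -/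
theorem pair_id_snd [IsCommComonObj A] [IsCommComonObj B] :
    pair (𝟙 (A ⊗ B)) (snd A B) = A ◁ Δ[B] ≫ (α_ A B B).inv := by
  have h : pair (𝟙 (A ⊗ B)) (snd A B) = pair (pair (fst A B) (snd A B)) (snd A B) := by
    rw [pair_fst_snd]
  have h' : pair (snd A B) (snd A B) = snd A B ≫ Δ[B] := by
    rw [IsComonHom.hom_comul, pair]
  rw [h, ← pair_associator_inv, h', ← pair_whiskerLeft, pair_fst_snd, Category.id_comp]

/-- A tap of the first factor of a tensor product has to cross the second factor. -/
theorem pair_id_fst_comp [IsCommComonObj A] [IsCommComonObj B] {X : C} (f : A ⟶ X) :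
    pair (𝟙 (A ⊗ B)) (fst A B ≫ f) =
      pair (𝟙 A) f ▷ B ≫ (α_ A X B).hom ≫ A ◁ (β_ X B).hom ≫ (α_ A B X).inv := by
  have h : pair (𝟙 (A ⊗ B)) (fst A B ≫ f) = pair (pair (fst A B) (snd A B)) (fst A B ≫ f) := by
    rw [pair_fst_snd]
  have h' : pair (𝟙 A) f ▷ B = pair (pair (fst A B) (fst A B ≫ f)) (snd A B) := by
    rw [← Category.id_comp (pair (𝟙 A) f ▷ B), ← pair_fst_snd, pair_whiskerRight, comp_pair,
      Category.comp_id]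
  rw [h, h', ← Category.assoc, pair_associator, ← Category.assoc, pair_whiskerLeft, pair_braiding,
    pair_associator_inv]

instance isComonHom_conv [IsCommComonObj A] (m : B ⊗ B ⟶ B) [IsComonHom m] (f g : A ⟶ B)
    [IsComonHom f] [IsComonHom g] : IsComonHom (conv m f g) :=
  inferInstanceAs (IsComonHom (pair f g ≫ m))

namespace Effect

/-- Effects on a commutative comonoid multiply by copying the input. -/
instance [IsCommComonObj A] : CommMonoid (Effect A) where
  mul e e' := ⟨conv (λ_ (𝟙_ C)).hom e.hom e'.hom⟩
  one := ⟨ε⟩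
  mul_assoc e f g := Effect.ext (conv_assoc (by monoidal) _ _ _)
  one_mul e := Effect.ext (counit_pair e.hom)
  mul_one e := Effect.ext <| by
    change pair e.hom ε[A] ≫ (λ_ _).hom = e.hom
    rw [unitors_equal, pair_counit]
  mul_comm e f := Effect.ext (conv_comm (by rw [braiding_leftUnitor, unitors_equal]) _ _)

theorem mul_hom [IsCommComonObj A] (e f : Effect A) :
    (e * f).hom = pair e.hom f.hom ≫ (λ_ (𝟙_ C)).hom := rfl

theorem box_one [IsCommComonObj A] : (1 : Effect A).box = 𝟙 A := pair_counit _

theorem box_mul [IsCommComonObj A] (e f : Effect A) : (e * f).box = e.box ≫ f.box := by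
  have h : (α_ A (𝟙_ C) (𝟙_ C)).hom ≫ A ◁ (λ_ (𝟙_ C)).hom ≫ (ρ_ A).hom =
      (ρ_ A).hom ▷ 𝟙_ C ≫ (ρ_ A).hom := by monoidal
  rw [box_comp, mul_comm, box, mul_hom, box, ← pair_whiskerRight,
    ← pair_whiskerLeft, ← pair_associator, Category.assoc, Category.assoc, h, Category.assoc]

/-- The parallel composite of two effects. -/
def prod (e : Effect A) (f : Effect B) : Effect (A ⊗ B) := ⟨(e.hom ⊗ₘ f.hom) ≫ (λ_ (𝟙_ C)).hom⟩

theorem box_prod (e : Effect A) (f : Effect B) : (e.prod f).box = e.box ⊗ₘ f.box := by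
  rw [box, prod, ← pair_whiskerLeft, ← id_tensorHom_id, pair_tensor, box, box,
    ← tensorHom_comp_tensorHom, Category.assoc, Category.assoc]
  congr 1
  rw [rightUnitor_monoidal]

/-- Precomposition with a comonoid morphism, as a map of effects. -/
def comap [IsCommComonObj A] [IsCommComonObj B] (d : B ⟶ A) [IsComonHom d] :
    Effect A →* Effect B where
  toFun e := ⟨d ≫ e.hom⟩
  map_one' := Effect.ext (IsComonHom.hom_counit d)
  map_mul' _ _ := Effect.ext (comp_conv d _ _ _)

/-- A parallel composite is a product of effects that each ignore one of the factors. -/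
theorem prod_eq [IsCommComonObj A] [IsCommComonObj B] (e : Effect A) (f : Effect B) :
    e.prod f = comap (fst A B) e * comap (snd A B) f := by
  ext
  rw [mul_hom, comap, comap]
  change _ = pair (fst A B ≫ e.hom) (snd A B ≫ f.hom) ≫ _
  rw [← pair_map, pair_fst_snd, Category.id_comp, prod]

end Effect

end Comonoid

/-! ### Spiders on a single wire -/

/-- The single wire.  It is a definition of its own, because its comonoid structure (the green copy
spider) and that of `wires 1` (built from the empty bundle) are not definitionally equal. -/
def W : Wires := wires 1

/-- The spider of colour `c` with two inputs and one output. -/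
def mul (c : Color) : W ⊗ W ⟶ W := (ZX.spider c 0 2 1).mk
/-- The spider of colour `c` with one input and two outputs. -/
def comul (c : Color) : W ⟶ W ⊗ W := (ZX.spider c 0 1 2).mk
/-- The spider of colour `c` with a single output.  The red states of phase `0` and `π` are, up to
a scalar, the basis states `|0⟩` and `|1⟩`. -/
def state (c : Color) (θ : Real.Angle) : 𝟙_ Wires ⟶ W := (ZX.spider c θ 0 1).mk
/-- The spider of colour `c` with a single input. -/
def effect (c : Color) (θ : Real.Angle) : W ⟶ 𝟙_ Wires := (ZX.spider c θ 1 0).mk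
/-- The spider of colour `c` with one input and one output. -/
def phase (c : Color) (θ : Real.Angle) : W ⟶ W := (ZX.spider c θ 1 1).mk
/-- The spider of colour `c` with three inputs and one output. -/
def mul₃ (c : Color) : (W ⊗ W) ⊗ W ⟶ W := (ZX.spider c 0 3 1).mk
/-- The spider of colour `c` with one input and three outputs. -/
def comul₃ (c : Color) : W ⟶ W ⊗ W ⊗ W := (ZX.spider c 0 1 3).mk
/-- The cup. -/
def cupW : W ⊗ W ⟶ 𝟙_ Wires := ZX.cup.mk
/-- The cap. -/
def capW : 𝟙_ Wires ⟶ W ⊗ W := ZX.cap.mk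
/-- The triangle. -/
def tri : W ⟶ W := ZX.triangle.mk

open ZX

/-- Fusion of two spiders, the second of which has all its inputs joined to the first. -/
theorem fuse_right (c : Color) {α β γ : Real.Angle} (h : α + β = γ) (a b k e : ℕ) :
    (spider c α a (b + (k + 1)) ⨟ (ZX.id b ⊠ spider c β (k + 1) e)).mk =
      (spider c γ a (b + e)).mk := by
  subst h
  refine mk_eq_mk.2 (.trans (.seq_congr ?_ (.refl _)) (.S1 c α β a b k 0 e))
  exact .trans (.symm (.tensor_empty _)) (.symm (.seq_id _))

theorem fuse (c : Color) {α β γ : Real.Angle} (h : α + β = γ) (a b k d e : ℕ) :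
    ((spider c α a (b + (k + 1)) ⊠ ZX.id d) ⨟ wire (Nat.add_assoc b (k + 1) d)).mk ≫
      (ZX.id b ⊠ spider c β (k + 1 + d) e).mk = (spider c γ (a + d) (b + e)).mk := by
  subst h
  exact mk_eq_mk.2 (.S1 c α β a b k d e)

theorem comul_effect (c : Color) (θ : Real.Angle) :
    comul c ≫ W ◁ effect c θ = phase c θ ≫ (ρ_ W).inv := by
  have h := fuse_right c (zero_add θ) 1 1 0 0
  exact h.trans (Category.comp_id (phase c θ)).symm

theorem phase_zero (c : Color) : phase c 0 = 𝟙 W := mk_eq_mk.2 (.S2 c)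

theorem empty_tensor_mk_one_zero (f : ZX 1 0) : (ZX.id 0 ⊠ f : ZX 1 0).mk = f.mk :=
  mk_eq_mk.2 (.trans (.symm (.seq_id _)) (.trans (.empty_tensor f) (.id_seq f)))

theorem empty_tensor_mk_one_one (f : ZX 1 1) : (ZX.id 0 ⊠ f : ZX 1 1).mk = f.mk :=
  mk_eq_mk.2 (.trans (.symm (.seq_id _)) (.trans (.empty_tensor f) (.id_seq f)))

theorem empty_tensor_mk_two_zero (f : ZX 2 0) : (ZX.id 0 ⊠ f : ZX 2 0).mk = f.mk :=
  mk_eq_mk.2 (.trans (.symm (.seq_id _)) (.trans (.empty_tensor f) (.id_seq f)))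

theorem empty_tensor_mk_two_one (f : ZX 2 1) : (ZX.id 0 ⊠ f : ZX 2 1).mk = f.mk :=
  mk_eq_mk.2 (.trans (.symm (.seq_id _)) (.trans (.empty_tensor f) (.id_seq f)))

theorem empty_tensor_mk_two_two (f : ZX 2 2) : (ZX.id 0 ⊠ f : ZX 2 2).mk = f.mk :=
  mk_eq_mk.2 (.trans (.symm (.seq_id _)) (.trans (.empty_tensor f) (.id_seq f)))

theorem tensor_empty_mk {n m : ℕ} (f : ZX n m) : (f ⊠ ZX.id 0 : ZX n m).mk = f.mk :=
  mk_eq_mk.2 (.tensor_empty f)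

theorem phase_effect (c : Color) (θ φ : Real.Angle) :
    phase c θ ≫ effect c φ = effect c (θ + φ) := by
  have h := fuse_right c (rfl : θ + φ = _) 1 0 0 0
  exact (congrArg (phase c θ ≫ ·) (empty_tensor_mk_one_zero (spider c φ 1 0)).symm).trans h

theorem state_phase (c : Color) (θ φ : Real.Angle) :
    state c θ ≫ phase c φ = state c (θ + φ) := by
  have h := fuse_right c (rfl : θ + φ = _) 0 0 0 1
  exact (congrArg (state c θ ≫ ·) (empty_tensor_mk_one_one (spider c φ 1 1)).symm).trans h

theorem mul_effect (c : Color) : mul c ≫ effect c 0 = cupW := by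
  have h := fuse_right c (zero_add 0) 2 0 0 0
  exact (congrArg (mul c ≫ ·) (empty_tensor_mk_one_zero (spider c 0 1 0)).symm).trans
    (h.trans (mk_eq_mk.2 (.S3' c)))

theorem comul_comul (c : Color) :
    comul c ≫ W ◁ comul c = comul₃ c := by
  have h := fuse_right c (zero_add 0) 1 1 0 2
  exact h

theorem mul_mul (c : Color) :
    mul c ▷ W ≫ mul c = mul₃ c := by
  have h := fuse c (add_zero 0) 2 0 0 1 1
  refine Eq.trans ?_ h
  exact congrArg₂ (· ≫ ·) (Category.comp_id (mul c ▷ W)).symm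
    (empty_tensor_mk_two_one (spider c 0 2 1)).symm

theorem state_mul (c : Color) : state c 0 ▷ W ≫ mul c = (λ_ W).hom := by
  have h := fuse c (add_zero 0) 0 0 0 1 1
  refine Eq.trans ?_ (h.trans (phase_zero c))
  exact congrArg₂ (· ≫ ·) (Category.comp_id (state c 0 ▷ W)).symm
    (empty_tensor_mk_two_one (spider c 0 2 1)).symm

theorem state_cup (c : Color) (θ : Real.Angle) :
    state c θ ▷ W ≫ cupW = (λ_ W).hom ≫ effect c θ := by
  have h := fuse c (add_zero θ) 0 0 0 1 0
  refine Eq.trans ?_ (h.trans (Category.id_comp (effect c θ)).symm)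
  refine congrArg₂ (· ≫ ·) (Category.comp_id (state c θ ▷ W)).symm
    (((empty_tensor_mk_two_zero (spider c 0 2 0))).trans (mk_eq_mk.2 (.S3' c))).symm

/-- Bending the second input of a two-input spider to an output. -/
theorem mul_eq_comul_cup (c : Color) :
    mul c = comul c ▷ W ≫ (α_ W W W).hom ≫ W ◁ cupW ≫ (ρ_ W).hom := by
  have h := fuse c (add_zero 0) 1 1 0 1 0
  have h' : (spider c 0 2 0).mk = ZX.cup.mk := mk_eq_mk.2 (.S3' c)
  rw [mk_tensor] at h
  refine h.symm.trans ?_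
  refine (congrArg₂ (· ≫ ·) (Eq.refl _) ((congrArg (𝟙 W ⊗ₘ ·) h').trans
    (Category.comp_id (W ◁ cupW)).symm)).trans ?_
  exact Category.assoc (comul c ▷ W) (𝟙 _) (W ◁ cupW ≫ (ρ_ W).hom)

theorem braiding_mul (c : Color) : (β_ W W).hom ≫ mul c = mul c := by
  have h := mk_eq_mk.2 (Derivable.swap_spider c 0 0 0 1)
  refine Eq.trans ?_ h
  exact congrArg (· ≫ mul c) ((tensor_empty_mk _).trans (empty_tensor_mk_two_two _)).symm

theorem comul_braiding (c : Color) : comul c ≫ (β_ W W).hom = comul c := by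
  have h := mk_eq_mk.2 (Derivable.spider_swap c 0 1 0 0)
  refine Eq.trans ?_ h
  exact congrArg (comul c ≫ ·) ((tensor_empty_mk _).trans (empty_tensor_mk_two_two _)).symm

theorem mul_assoc_W (c : Color) : mul c ▷ W ≫ mul c = (α_ W W W).hom ≫ W ◁ mul c ≫ mul c := by
  have h1 : (β_ W W).hom ▷ W ≫ mul₃ c = mul₃ c := by
    have h := mk_eq_mk.2 (Derivable.swap_spider c 0 0 1 1)
    refine Eq.trans ?_ h
    exact congrArg (fun f => f ▷ W ≫ mul₃ c)
      (empty_tensor_mk_two_two ZX.σ).symm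
  have h2 : (α_ W W W).hom ≫ W ◁ (β_ W W).hom ≫ (α_ W W W).inv ≫
      mul₃ c = mul₃ c := by
    have h := mk_eq_mk.2 (Derivable.swap_spider c 0 1 0 1)
    refine Eq.trans ?_ h
    refine (Category.id_comp (W ◁ (β_ W W).hom ≫ (α_ W W W).inv ≫
      mul₃ c)).trans ?_
    refine (congrArg (W ◁ (β_ W W).hom ≫ ·) (Category.id_comp (mul₃ c))).trans ?_
    exact congrArg (· ≫ ((spider c 0 3 1).mk : W ⊗ W ⊗ W ⟶ W)) (tensor_empty_mk _).symm
  -- commutativity turns the right-nested product into the left-nested one, with rotated inputs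
  have h3 : W ◁ mul c ≫ mul c = (β_ W (W ⊗ W)).hom ≫ mul c ▷ W ≫ mul c := by
    rw [← BraidedCategory.braiding_naturality_right_assoc, braiding_mul]
  rw [h3, mul_mul, BraidedCategory.braiding_tensor_right_hom]
  simp only [Category.assoc, Iso.hom_inv_id_assoc]
  rw [h2, h1]

theorem comul_assoc_W (c : Color) :
    comul c ≫ W ◁ comul c = comul c ≫ comul c ▷ W ≫ (α_ W W W).hom := by
  have h1 : (comul₃ c ≫ (α_ W W W).inv) ≫ (β_ W W).hom ▷ W ≫
      (α_ W W W).hom = comul₃ c := by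
    have h := mk_eq_mk.2 (Derivable.spider_swap c 0 1 0 1)
    refine Eq.trans ?_ h
    refine (congrArg₂ (fun (f : W ⟶ (W ⊗ W) ⊗ W) (g : (W ⊗ W) ⊗ W ⟶ W ⊗ W ⊗ W) => f ≫ g)
      (Category.comp_id (comul₃ c)) (Category.comp_id ((β_ W W).hom ▷ W))).trans ?_
    exact congrArg (fun f : W ⊗ W ⟶ W ⊗ W => comul₃ c ≫ f ▷ W) (empty_tensor_mk_two_two ZX.σ).symm
  have h2 : comul₃ c ≫ W ◁ (β_ W W).hom = comul₃ c := by
    have h := mk_eq_mk.2 (Derivable.spider_swap c 0 1 1 0)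
    refine Eq.trans ?_ h
    exact congrArg (comul₃ c ≫ ·) (tensor_empty_mk _).symm
  have h3 : comul c ≫ comul c ▷ W = (comul c ≫ W ◁ comul c) ≫ (β_ W (W ⊗ W)).hom := by
    rw [Category.assoc, BraidedCategory.braiding_naturality_right, ← Category.assoc,
      comul_braiding]
  simp only [Category.assoc] at h1
  rw [← Category.assoc, h3, comul_comul, BraidedCategory.braiding_tensor_right_hom]
  simp only [Category.assoc, Iso.inv_hom_id, Category.comp_id]
  rw [reassoc_of% h1, h2]

/-- The green copy and discard spiders. -/
instance : ComonObj W where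
  counit := effect .green 0
  comul := comul .green
  counit_comul := by
    rw [← comul_braiding, Category.assoc, ← BraidedCategory.braiding_naturality_right,
      ← Category.assoc, comul_effect, phase_zero, Category.id_comp, rightUnitor_inv_braiding]
  comul_counit := by rw [comul_effect, phase_zero, Category.id_comp]
  comul_assoc := comul_assoc_W .green

instance : IsCommComonObj W where
  comul_comm := comul_braiding .green

/-! ### Basis states, XOR and the triangle -/

theorem state_effect_other (c : Color) {κ : Real.Angle} (h : κ = 0 ∨ κ = piAngle) :
    state c κ ≫ effect c.other 0 = 𝟙 (𝟙_ Wires) := mk_eq_mk.2 (.B1 c κ h)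

theorem state_comul_other (c : Color) {κ : Real.Angle} (h : κ = 0 ∨ κ = piAngle) :
    state c κ ≫ comul c.other = (λ_ (𝟙_ Wires)).inv ≫ (state c κ ⊗ₘ state c κ) :=
  (mk_eq_mk.2 (.B2 c κ h)).trans (Category.id_comp (state c κ ⊗ₘ state c κ)).symm

/-- Plugging a basis state of one colour into a spider of the other colour projects to it. -/
theorem state_mul_other (c : Color) {κ : Real.Angle} (h : κ = 0 ∨ κ = piAngle) :
    state c κ ▷ W ≫ mul c.other = (λ_ W).hom ≫ effect c κ ≫ state c κ := by
  rw [mul_eq_comul_cup, ← comp_whiskerRight_assoc, state_comul_other c h]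
  have h1 : (state c κ ⊗ₘ state c κ) ▷ W ≫ (α_ W W W).hom ≫ W ◁ cupW =
      (α_ _ _ _).hom ≫ 𝟙_ Wires ◁ (λ_ W).hom ≫ 𝟙_ Wires ◁ effect c κ ≫ state c κ ▷ 𝟙_ Wires := by
    rw [← tensorHom_id, associator_naturality_assoc, tensorHom_id, ← id_tensorHom W cupW,
      tensorHom_comp_tensorHom, state_cup, Category.comp_id, MonoidalCategory.tensorHom_def',
      whiskerLeft_comp_assoc]
  rw [comp_whiskerRight_assoc, reassoc_of% h1, rightUnitor_naturality]
  monoidal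

/-- The transpose of the rule that basis states are copied. -/
theorem mul_other_effect (c : Color) {κ : Real.Angle} (h : κ = 0 ∨ κ = piAngle) :
    mul c.other ≫ effect c κ = (effect c κ ⊗ₘ effect c κ) ≫ (λ_ (𝟙_ Wires)).hom := by
  -- bend the effect to a state, slide it past the spider, and project with it there
  have h0 : effect c κ = (λ_ W).inv ≫ state c κ ▷ W ≫ cupW := by
    rw [state_cup, Iso.inv_hom_id_assoc]
  have h1 : W ◁ mul c.other ≫ cupW = (α_ W W W).inv ≫ mul c.other ▷ W ≫ cupW := by
    rw [← mul_effect c.other, reassoc_of% (mul_assoc_W c.other), Iso.inv_hom_id_assoc]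
  have h2 : state c κ ▷ W ▷ W ≫ mul c.other ▷ W =
      ((λ_ W).hom ≫ effect c κ ≫ state c κ) ▷ W := by
    rw [← comp_whiskerRight, state_mul_other c h]
  calc mul c.other ≫ effect c κ
      = (λ_ (W ⊗ W)).inv ≫ state c κ ▷ (W ⊗ W) ≫ W ◁ mul c.other ≫ cupW := by
        rw [h0, leftUnitor_inv_naturality_assoc, whisker_exchange_assoc]
    _ = (λ_ (W ⊗ W)).inv ≫ (α_ _ _ _).inv ≫ state c κ ▷ W ▷ W ≫ mul c.other ▷ W ≫ cupW := by
        rw [h1, associator_inv_naturality_left_assoc]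
    _ = effect c κ ▷ W ≫ state c κ ▷ W ≫ cupW := by
        rw [reassoc_of% h2]; simp
    _ = _ := by
        rw [state_cup, MonoidalCategory.tensorHom_def, Category.assoc, leftUnitor_naturality]

/-- The crossing of the middle two of four wires is the middle-four interchange. -/
theorem tensorμ_W : tensorμ W W W W =
    ((ZX.id 1 ⊠ ZX.σ ⊠ ZX.id 1 : ZX 4 4).mk : (W ⊗ W) ⊗ (W ⊗ W) ⟶ (W ⊗ W) ⊗ (W ⊗ W)) := by
  have h1 : W ◁ (α_ W W W).inv = 𝟙 (W ⊗ W ⊗ W ⊗ W) := tensor_id 1 3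
  have h2 : W ◁ (α_ W W W).hom = 𝟙 (W ⊗ W ⊗ W ⊗ W) := tensor_id 1 3
  have h3 : tensorμ W W W W = ((α_ W W (W ⊗ W)).hom ≫ W ◁ (α_ W W W).inv ≫ (α_ W _ W).inv) ≫
      (W ◁ (β_ W W).hom) ▷ W ≫ ((α_ W _ W).hom ≫ W ◁ (α_ W W W).hom ≫ (α_ W W (W ⊗ W)).inv) := by
    simp [tensorμ]
  have h4 : (α_ W W (W ⊗ W)).hom ≫ W ◁ (α_ W W W).inv ≫ (α_ W _ W).inv = 𝟙 ((W ⊗ W) ⊗ W ⊗ W) := by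
    refine (congrArg (fun f => (α_ W W (W ⊗ W)).hom ≫ f ≫ (α_ W (W ⊗ W) W).inv) h1).trans ?_
    exact (Category.id_comp (𝟙 (wires 4) ≫ 𝟙 (wires 4))).trans (Category.id_comp _)
  have h5 : (α_ W _ W).hom ≫ W ◁ (α_ W W W).hom ≫ (α_ W W (W ⊗ W)).inv =
      𝟙 ((W ⊗ W) ⊗ W ⊗ W) := by
    refine (congrArg (fun f => (α_ W (W ⊗ W) W).hom ≫ f ≫ (α_ W W (W ⊗ W)).inv) h2).trans ?_
    exact (Category.id_comp (𝟙 (wires 4) ≫ 𝟙 (wires 4))).trans (Category.id_comp _)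
  rw [h3, h4, h5]
  exact (Category.id_comp ((W ◁ (β_ W W).hom) ▷ W ≫ 𝟙 ((W ⊗ W) ⊗ W ⊗ W))).trans
    (Category.comp_id ((W ◁ (β_ W W).hom) ▷ W))

/-- The classical XOR. -/
def xorW : W ⊗ W ⟶ W := mul .red

instance : IsComonHom xorW where
  hom_counit := mul_other_effect .green (.inl rfl)
  hom_comul := by
    rw [Comon.tensorObj_comul, tensorμ_W]
    exact mk_eq_mk.2 (.B3 .red)

/-- The inverse of the triangle. -/
def triInv : W ⟶ W := phase .green piAngle ≫ tri ≫ phase .green piAngle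

theorem tri_triInv : tri ≫ triInv = 𝟙 W := by
  refine Eq.trans ?_ (mk_eq_mk.2 .T3)
  exact congrArg (tri ≫ ·) (Category.assoc (phase .green piAngle) tri (phase .green piAngle)).symm

theorem phase_phase (c : Color) (θ φ : Real.Angle) :
    phase c θ ≫ phase c φ = phase c (θ + φ) := by
  have h := fuse_right c (rfl : θ + φ = _) 1 0 0 1
  exact (congrArg (phase c θ ≫ ·) (empty_tensor_mk_one_one (spider c φ 1 1)).symm).trans h

theorem piAngle_add_piAngle : piAngle + piAngle = 0 := by
  rw [piAngle, ← Real.Angle.coe_add, ← two_mul, Real.Angle.coe_two_pi]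

theorem phase_pi_phase_pi (c : Color) : phase c piAngle ≫ phase c piAngle = 𝟙 W := by
  rw [phase_phase, piAngle_add_piAngle, phase_zero]

theorem triInv_tri : triInv ≫ tri = 𝟙 W := by
  have h := tri_triInv
  rw [triInv] at h
  have h' : phase .green piAngle ≫ (tri ≫ phase .green piAngle ≫ tri ≫ phase .green piAngle) ≫
      phase .green piAngle = 𝟙 W := by rw [h, Category.id_comp, phase_pi_phase_pi]
  simpa [triInv, phase_pi_phase_pi] using h'

theorem state_zero_tri : state .red 0 ≫ tri = state .red 0 := mk_eq_mk.2 .T1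

theorem state_pi_tri : state .red piAngle ≫ tri = state .green 0 := mk_eq_mk.2 .T2

theorem state_zero_triInv : state .red 0 ≫ triInv = state .red 0 := by
  rw [← state_zero_tri, Category.assoc, tri_triInv, Category.comp_id, state_zero_tri]

theorem sum_fin_one {f : (Fin 1 → Fin 2) → ℂ} : ∑ x, f x = f (fun _ => 0) + f (fun _ => 1) := by
  rw [← (Equiv.funUnique (Fin 1) (Fin 2)).symm.sum_comp, Fin.sum_univ_two]
  rfl

theorem state_green_effect_red : state .green 0 ≫ effect .red piAngle = 𝟙 (𝟙_ Wires) := by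
  refine mk_eq_mk.2 (.scalar (spider .green 0 0 1 ⨟ spider .red piAngle 1 0) ?_)
  rw [ZX.interp, Matrix.mul_apply, sum_fin_one]
  norm_num [ZX.interp]

theorem state_zero_effect_green (θ : Real.Angle) :
    state .red 0 ≫ effect .green θ = 𝟙 (𝟙_ Wires) := by
  refine mk_eq_mk.2 (.scalar (spider .red 0 0 1 ⨟ spider .green θ 1 0) ?_)
  rw [ZX.interp, Matrix.mul_apply, sum_fin_one]
  norm_num [ZX.interp]

theorem state_green_phase_red : state .green 0 ≫ phase .red piAngle = state .green 0 := by
  have h : phase .red piAngle = comul .red ≫ W ◁ effect .red piAngle ≫ (ρ_ W).hom := by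
    rw [← Category.assoc, comul_effect, Category.assoc, Iso.inv_hom_id, Category.comp_id]
  have h2 := state_comul_other .green (.inl rfl : (0 : Real.Angle) = 0 ∨ _)
  rw [Color.other] at h2
  rw [h, reassoc_of% h2, ← id_tensorHom, tensorHom_comp_tensorHom_assoc, Category.comp_id,
    state_green_effect_red, tensorHom_id, rightUnitor_naturality, ← unitors_equal,
    Iso.inv_hom_id_assoc]

/-- The transpose of the triangle. -/
def triT : W ⟶ W :=
  (ρ_ W).inv ≫ W ◁ capW ≫ (α_ W W W).inv ≫ (W ◁ tri) ▷ W ≫ cupW ▷ W ≫ (λ_ W).hom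

theorem triT_eq : phase .red piAngle ≫ tri ≫ phase .red piAngle = triT := by
  refine (Category.assoc _ _ _).symm.trans ((mk_eq_mk.2 .T4).trans ?_)
  rw [triangleT, mk_seq, mk_seq]
  refine (Category.assoc (W ◁ capW) ((W ◁ tri) ▷ W) (cupW ▷ W)).trans ?_
  refine Eq.trans ?_ (Category.id_comp (W ◁ capW ≫ (α_ W W W).inv ≫ (W ◁ tri) ▷ W ≫ cupW ▷ W ≫
    (λ_ W).hom)).symm
  refine congrArg (W ◁ capW ≫ ·) ?_
  refine Eq.trans ?_ (Category.id_comp ((W ◁ tri) ▷ W ≫ cupW ▷ W ≫ (λ_ W).hom)).symm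
  exact congrArg (fun f : (W ⊗ W) ⊗ W ⟶ W => (W ◁ tri) ▷ W ≫ f) (Category.comp_id (cupW ▷ W)).symm

theorem snake_W : capW ▷ W ≫ (α_ W W W).hom ≫ W ◁ cupW = (λ_ W).hom ≫ (ρ_ W).inv := by
  refine Eq.trans ?_ ((mk_eq_mk.2 .snake).trans (Category.id_comp (𝟙 W)).symm)
  exact congrArg (capW ▷ W ≫ ·) (Category.id_comp (W ◁ cupW))

/-- The transpose of `state .red 0 ≫ triT = state .green 0`; that equation comes from the triangle
rules, as `triT` is the triangle conjugated by red `π` phases. -/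
theorem tri_effect : tri ≫ effect .red 0 = effect .green 0 := by
  have h1 : state .red 0 ≫ triT = capW ≫ (tri ≫ effect .red 0) ▷ W ≫ (λ_ W).hom := by
    have h : state .red 0 ▷ (W ⊗ W) ≫ (α_ W W W).inv ≫ (W ◁ tri) ▷ W ≫ cupW ▷ W =
      (α_ _ _ _).inv ≫ (𝟙_ Wires ◁ tri) ▷ W ≫ ((λ_ W).hom ≫ effect .red 0) ▷ W := by
      rw [associator_inv_naturality_left_assoc, ← comp_whiskerRight_assoc, ← whisker_exchange,
        comp_whiskerRight_assoc, ← state_cup, comp_whiskerRight]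
    rw [triT, rightUnitor_inv_naturality_assoc, ← whisker_exchange_assoc, reassoc_of% h]
    simp only [comp_whiskerRight, Category.assoc]
    monoidal
  have h2 : state .red 0 ≫ triT = state .green 0 := by
    rw [← triT_eq, ← Category.assoc, state_phase, zero_add, ← Category.assoc, state_pi_tri,
      state_green_phase_red]
  have h3 : (λ_ W).hom ≫ tri ≫ effect .red 0 = state .green 0 ▷ W ≫ cupW := by
    rw [← h2, h1]
    have h : ((tri ≫ effect .red 0) ▷ W) ▷ W ≫ (λ_ W).hom ▷ W ≫ cupW =
        (α_ W W W).hom ≫ W ◁ cupW ≫ (ρ_ W).hom ≫ tri ≫ effect .red 0 := by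
      rw [← rightUnitor_naturality, whisker_exchange_assoc]
      simp
      monoidal
    simp only [comp_whiskerRight, Category.assoc] at h ⊢
    rw [h, reassoc_of% snake_W, Iso.inv_hom_id_assoc]
  rw [state_cup] at h3
  exact (cancel_epi _).1 h3

/-! ### Boolean functions and the phases they kick back -/

/-- The two-input AND gate. -/
def andW : W ⊗ W ⟶ W := (tri ⊗ₘ tri) ≫ mul .green ≫ triInv

theorem triangleInv_mk : (ZX.triangleInv.mk : W ⟶ W) = triInv :=
  Category.assoc (phase .green piAngle) tri (phase .green piAngle)

theorem andGate_two_mk : ((ZX.andGate 2).mk : W ⊗ W ⟶ W) = andW := by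
  have h : (ZX.power ZX.triangle 2).mk = (tri ⊗ₘ tri : W ⊗ W ⟶ W ⊗ W) :=
    congrArg (· ⊗ₘ tri) (empty_tensor_mk_one_one ZX.triangle)
  refine (congrArg₂ (fun (f : W ⊗ W ⟶ W ⊗ W) (g : W ⟶ W) => (f ≫ mul .green) ≫ g) h
    triangleInv_mk).trans ?_
  rw [andW, Category.assoc]

theorem triInv_effect : triInv ≫ effect .green 0 = effect .red 0 := by
  rw [← tri_effect, ← Category.assoc, triInv_tri, Category.id_comp]

instance : IsComonHom andW where
  hom_counit := by
    change andW ≫ effect .green 0 = (effect .green 0 ⊗ₘ effect .green 0) ≫ (λ_ _).hom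
    rw [andW, Category.assoc, Category.assoc, triInv_effect]
    rw [show mul .green ≫ effect .red 0 = _ from mul_other_effect .red (.inl rfl)]
    rw [tensorHom_comp_tensorHom_assoc, tri_effect]
  hom_comul := by
    rw [Comon.tensorObj_comul, tensorμ_W, ← andGate_two_mk]
    exact mk_eq_mk.2 .A3

/-- AND distributes over XOR. -/
theorem xor_and : xorW ▷ W ≫ andW =
    (W ⊗ W) ◁ Δ[W] ≫ tensorμ W W W W ≫ (andW ⊗ₘ andW) ≫ xorW := by
  rw [tensorμ_W, ← andGate_two_mk]
  refine (mk_eq_mk.2 .A1).trans ?_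
  rw [mk_seq, mk_seq, mk_seq, Category.assoc, Category.assoc]
  exact congrArg (fun f : W ⊗ W ⟶ W ⊗ W => (f ⊗ₘ Δ[W]) ≫ _) (tensor_id 1 1)

theorem copy_and : Δ[W] ≫ andW = 𝟙 W := by
  rw [← andGate_two_mk]
  exact mk_eq_mk.2 .A2

/-- The Boolean functions on `A`: the morphisms to a single wire that commute with copying and
discarding. -/
@[ext]
structure Point (A : Wires) [ComonObj A] where
  /-- The underlying morphism. -/
  hom : A ⟶ W
  [isComonHom : IsComonHom hom]

attribute [instance] Point.isComonHom

namespace Point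

variable {A B : Wires} [ComonObj A] [ComonObj B]

/-- Conjugation by the triangle turns AND into a green spider. -/
theorem conv_and (f g : A ⟶ W) :
    conv andW f g = conv (mul .green) (f ≫ tri) (g ≫ tri) ≫ triInv := by
  rw [conv, andW, ← Category.assoc, pair_map, conv, Category.assoc]

theorem isComonHom_state {κ : Real.Angle} (h : κ = 0 ∨ κ = piAngle) :
    IsComonHom (ε[A] ≫ state .red κ) where
  hom_counit := by
    rw [Category.assoc]
    exact (congrArg (ε[A] ≫ ·) (state_effect_other .red h)).trans (Category.comp_id _)
  hom_comul := by
    rw [Category.assoc]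
    refine (congrArg (ε[A] ≫ ·) (state_comul_other .red h)).trans ?_
    have h' := pair_map ε[A] ε[A] (state .red κ) (state .red κ)
    rw [pair] at h'
    refine Eq.trans ?_ h'
    rw [ComonObj.counit_comul_hom, Category.assoc]

variable (A) in
/-- The constant Boolean function whose value is the basis state of phase `κ`. -/
def const {κ : Real.Angle} (h : κ = 0 ∨ κ = piAngle) : Point A :=
  @Point.mk A _ (ε[A] ≫ state .red κ) (isComonHom_state h)

instance : Zero (Point A) := ⟨const A (.inl rfl)⟩
instance : One (Point A) := ⟨const A (.inr rfl)⟩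

theorem zero_hom : (0 : Point A).hom = ε[A] ≫ state .red 0 := rfl
theorem one_hom : (1 : Point A).hom = ε[A] ≫ state .red piAngle := rfl

variable [IsCommComonObj A] [IsCommComonObj B]

instance : Add (Point A) := ⟨fun f g => ⟨conv xorW f.hom g.hom⟩⟩
instance : Mul (Point A) := ⟨fun f g => ⟨conv andW f.hom g.hom⟩⟩
theorem add_hom (f g : Point A) : (f + g).hom = conv xorW f.hom g.hom := rfl
theorem mul_hom (f g : Point A) : (f * g).hom = conv andW f.hom g.hom := rfl
theorem add_comm' (f g : Point A) : f + g = g + f := Point.ext (conv_comm (braiding_mul .red) _ _)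

theorem mul_comm' (f g : Point A) : f * g = g * f := by
  ext
  rw [mul_hom, mul_hom, conv_and, conv_and, conv_comm (braiding_mul .green)]

theorem zero_add' (f : Point A) : 0 + f = f := by
  ext
  rw [add_hom, zero_hom, conv_left (v := 𝟙 W), Category.comp_id]
  rw [Category.comp_id]
  exact state_mul .red

theorem zero_mul' (f : Point A) : 0 * f = 0 := by
  ext
  rw [mul_hom, zero_hom, conv_and, Category.assoc, state_zero_tri,
    conv_left (m := mul .green) (state_mul_other .red (.inl rfl))]
  simp only [Category.assoc]
  rw [state_zero_triInv, reassoc_of% tri_effect]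
  exact IsComonHom.hom_counit_assoc f.hom _

theorem one_mul' (f : Point A) : 1 * f = f := by
  ext
  rw [mul_hom, one_hom, conv_and, Category.assoc, state_pi_tri, conv_left (v := 𝟙 W)]
  · rw [Category.comp_id, Category.assoc, tri_triInv, Category.comp_id]
  · rw [Category.comp_id]
    exact state_mul .green

theorem add_mul' (f g h : Point A) : (f + g) * h = f * h + g * h := by
  ext
  change conv andW (conv xorW f.hom g.hom) h.hom =
    conv xorW (conv andW f.hom h.hom) (conv andW g.hom h.hom)
  rw [conv, conv, ← pair_whiskerRight, Category.assoc, xor_and, ← Category.assoc,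
    pair_whiskerLeft, IsComonHom.hom_comul, ← pair, ← Category.assoc, pair_tensorμ,
    ← Category.assoc, pair_map]
  rfl

/-- Boolean functions form a commutative semiring under XOR and AND. -/
instance : CommSemiring (Point A) where
  add_assoc f g h := Point.ext (conv_assoc (mul_assoc_W .red) _ _ _)
  zero_add := zero_add'
  add_zero f := by rw [add_comm', zero_add']
  add_comm := add_comm'
  nsmul := nsmulRec
  left_distrib f g h := by rw [mul_comm', add_mul', mul_comm' g, mul_comm' h]
  right_distrib := add_mul'
  zero_mul := zero_mul'
  mul_zero f := by rw [mul_comm', zero_mul']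
  mul_assoc f g h := by
    ext
    simp only [mul_hom, conv_and, Category.assoc, triInv_tri, Category.comp_id]
    rw [conv_assoc (mul_assoc_W .green)]
  one_mul := one_mul'
  mul_one f := by rw [mul_comm', one_mul']
  mul_comm := mul_comm'

theorem mul_self (f : Point A) : f * f = f := by
  ext
  rw [mul_hom, conv, pair, ← IsComonHom.hom_comul, Category.assoc, copy_and, Category.comp_id]

/-- Precomposition with a comonoid morphism is a homomorphism of semirings. -/
def comap (d : B ⟶ A) [IsComonHom d] : Point A →+* Point B where
  toFun f := ⟨d ≫ f.hom⟩
  map_one' := Point.ext (IsComonHom.hom_counit_assoc d _)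
  map_zero' := Point.ext (IsComonHom.hom_counit_assoc d _)
  map_add' _ _ := Point.ext (comp_conv d _ _ _)
  map_mul' _ _ := Point.ext (comp_conv d _ _ _)

/-- Compute `f` and plug the phase `θ` into its value. -/
def kick (f : Point A) (θ : Real.Angle) : Effect A := ⟨f.hom ≫ effect .green θ⟩

theorem kick_comap (d : B ⟶ A) [IsComonHom d] (f : Point A) (θ : Real.Angle) :
    (comap d f).kick θ = Effect.comap d (f.kick θ) :=
  Effect.ext (Category.assoc _ _ _)

/-- A green phase on each of the two copies of a value adds up to a single phase. -/
theorem copy_effect (θ φ : Real.Angle) :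
    Δ[W] ≫ (effect .green θ ⊗ₘ effect .green φ) ≫ (λ_ (𝟙_ Wires)).hom = effect .green (θ + φ) := by
  rw [add_comm, ← phase_effect, MonoidalCategory.tensorHom_def', Category.assoc, unitors_equal,
    rightUnitor_naturality]
  change comul .green ≫ _ = _
  rw [reassoc_of% (comul_effect .green φ), Iso.inv_hom_id_assoc]

theorem kick_add (f : Point A) (θ φ : Real.Angle) : f.kick (θ + φ) = f.kick θ * f.kick φ := by
  ext
  rw [Effect.mul_hom]
  change f.hom ≫ effect .green (θ + φ) =
    pair (f.hom ≫ effect .green θ) (f.hom ≫ effect .green φ) ≫ _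
  rw [← pair_map, pair, ← IsComonHom.hom_comul, Category.assoc, Category.assoc, copy_effect]

theorem kick_angle_zero (f : Point A) : f.kick 0 = 1 := Effect.ext (IsComonHom.hom_counit f.hom)

theorem kick_zero (θ : Real.Angle) : (0 : Point A).kick θ = 1 := by
  ext
  exact (Category.assoc _ _ _).trans ((congrArg (ε[A] ≫ ·) (state_zero_effect_green θ)).trans
    (Category.comp_id _))

theorem kick_add_pi (f g : Point A) : (f + g).kick piAngle = f.kick piAngle * g.kick piAngle := by
  ext
  rw [Effect.mul_hom]
  change (pair f.hom g.hom ≫ xorW) ≫ effect .green piAngle =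
    pair (f.hom ≫ effect .green piAngle) (g.hom ≫ effect .green piAngle) ≫ _
  rw [← pair_map, Category.assoc, Category.assoc]
  exact congrArg _ (mul_other_effect .green (.inr rfl))

theorem kick_pi_sq (f : Point A) : f.kick piAngle * f.kick piAngle = 1 := by
  rw [← kick_add, piAngle_add_piAngle, kick_angle_zero]

end Point

/-! ### Expanding the phase of an XOR into phases of ANDs -/

namespace Point
variable {A B : Wires} [ComonObj A] [ComonObj B] [IsCommComonObj A] [IsCommComonObj B]

theorem kick_mul_kick_neg (f : Point A) (θ : Real.Angle) : f.kick θ * f.kick (-θ) = 1 := by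
  rw [← kick_add, add_neg_cancel, kick_angle_zero]

/-- A product over the non-empty subsets, with the singletons split off. -/
theorem prod_nonempty_subsets {ι M : Type*} [DecidableEq ι] [CommMonoid M] (s : Finset ι)
    (F : Finset ι → M) : ∏ t ∈ s.powerset with 1 ≤ t.card, F t =
      (∏ i ∈ s, F {i}) * ∏ t ∈ s.powerset with 2 ≤ t.card, F t := by
  have h : s.powerset.filter (fun t => 1 ≤ t.card) =
      s.powersetCard 1 ∪ s.powerset.filter (fun t => 2 ≤ t.card) := by
    ext t
    simp only [Finset.mem_filter, Finset.mem_powerset, Finset.mem_union, Finset.mem_powersetCard]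
    grind
  rw [h, Finset.prod_union, Finset.powersetCard_one, Finset.prod_map]
  · rfl
  · rw [Finset.disjoint_left]
    intro t ht
    simp only [Finset.mem_filter, Finset.mem_powerset, Finset.mem_powersetCard] at ht ⊢
    omega

/-- The phase of an XOR of arbitrarily many Boolean functions, expanded into phases of ANDs, given
the expansion for two functions. -/
theorem kick_sum
    (two : ∀ (α : ℝ) (f g : Point A), f.kick ((α / 2 : ℝ) : Real.Angle) *
      g.kick ((α / 2 : ℝ) : Real.Angle) * (f + g).kick ((-α / 2 : ℝ) : Real.Angle) =
        (f * g).kick (α : Real.Angle))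
    {ι : Type*} [DecidableEq ι] (s : Finset ι) (z : ι → Point A) (α : ℝ) :
    (∏ i ∈ s, (z i).kick ((α / 2 : ℝ) : Real.Angle)) *
        (∑ i ∈ s, z i).kick ((-α / 2 : ℝ) : Real.Angle) =
      ∏ t ∈ s.powerset with 2 ≤ t.card,
        (∏ i ∈ t, z i).kick (((-1) ^ t.card * 2 ^ (t.card - 2) * α : ℝ) : Real.Angle) := by
  induction s using Finset.induction_on generalizing z α with
  | empty => simp [kick_zero, Finset.filter_singleton]
  | insert a s ha ih =>
    set y := ∑ i ∈ s, z i
    have neg : ((-α / 2 : ℝ) : Real.Angle) = -((α / 2 : ℝ) : Real.Angle) := by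
      rw [neg_div, Real.Angle.coe_neg]
    -- the rule for the two functions `z a` and `y`
    have step : (z a).kick ((α / 2 : ℝ) : Real.Angle) * (z a + y).kick ((-α / 2 : ℝ) : Real.Angle)
        = y.kick ((-α / 2 : ℝ) : Real.Angle) * (z a * y).kick (α : Real.Angle) := by
      have h := kick_mul_kick_neg y ((α / 2 : ℝ) : Real.Angle)
      rw [← neg] at h
      rw [← two α (z a) y, mul_right_comm, mul_comm _ (_ * _), mul_assoc, h, mul_one]
    -- `z a * y` is the XOR of the `z a * z i`, to which the induction hypothesis applies with `-2α`
    have expand : (z a * y).kick (α : Real.Angle) =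
        ∏ t ∈ s.powerset with 1 ≤ t.card, (∏ i ∈ insert a t, z i).kick
          (((-1) ^ (t.card + 1) * 2 ^ (t.card + 1 - 2) * α : ℝ) : Real.Angle) := by
      have h := ih (fun i => z a * z i) (-2 * α)
      rw [← Finset.mul_sum, show -(-2 * α) / 2 = α by ring, show -2 * α / 2 = -α by ring] at h
      rw [prod_nonempty_subsets]
      have h1 : ∏ i ∈ s, (∏ j ∈ insert a {i}, z j).kick
          (((-1) ^ (({i} : Finset ι).card + 1) * 2 ^ (({i} : Finset ι).card + 1 - 2) * α : ℝ) :
            Real.Angle) = ∏ i ∈ s, (z a * z i).kick (α : Real.Angle) := by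
        refine Finset.prod_congr rfl fun i hi => ?_
        rw [Finset.prod_insert (by simp; rintro rfl; exact ha hi)]
        simp
      have h2 : ∏ t ∈ s.powerset with 2 ≤ t.card, (∏ i ∈ insert a t, z i).kick
          (((-1) ^ (t.card + 1) * 2 ^ (t.card + 1 - 2) * α : ℝ) : Real.Angle) =
          (∏ i ∈ s, (z a * z i).kick ((-α : ℝ) : Real.Angle)) *
            (z a * y).kick (α : Real.Angle) := by
        rw [h]
        refine Finset.prod_congr rfl fun t ht => ?_
        rw [Finset.mem_filter, Finset.mem_powerset] at ht
        obtain ⟨k, hk⟩ : ∃ k, t.card = k + 2 := ⟨t.card - 2, by omega⟩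
        have idem : IsIdempotentElem (z a) := mul_self (z a)
        -- `∏ i ∈ t, z a * z i` contains `z a` several times, which is the same as once
        rw [Finset.prod_insert (fun h => ha (ht.1 h)), Finset.prod_mul_distrib, Finset.prod_const,
          hk, idem.pow_eq (by omega), show k + 2 + 1 - 2 = k + 1 by omega, Nat.add_sub_cancel]
        congr 2
        ring
      rw [h1, h2, ← mul_assoc, ← Finset.prod_mul_distrib]
      simp [kick_mul_kick_neg]
    rw [Finset.prod_insert ha, Finset.sum_insert ha, mul_right_comm, step, mul_right_comm,
      mul_comm (y.kick _), ih, expand, Finset.prod_filter (s := (insert a s).powerset),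
      Finset.prod_powerset_insert ha, ← Finset.prod_filter, Finset.prod_filter (fun t => 1 ≤ _)]
    congr 1
    refine Finset.prod_congr rfl fun t ht => ?_
    rw [Finset.mem_powerset] at ht
    rw [Finset.card_insert_of_notMem fun h => ha (ht h)]
    simp [Nat.one_le_iff_ne_zero]

end Point

/-! ### Gates on `n` lines -/

attribute [local instance] ComonObj.instTensorUnit in
/-- Copying a bundle of wires copies every wire. -/
instance wiresComonObj : (n : ℕ) → ComonObj (wires n)
  | 0 => inferInstanceAs (ComonObj (𝟙_ Wires))
  | n + 1 =>
    letI := wiresComonObj n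
    inferInstanceAs (ComonObj (wires n ⊗ W))

instance wiresIsCommComonObj : (n : ℕ) → IsCommComonObj (wires n)
  | 0 => CommComon.instCommComonObjUnit
  | n + 1 =>
    letI := wiresIsCommComonObj n
    inferInstanceAs (IsCommComonObj (wires n ⊗ W))

/-- The value of the line `i`, as a Boolean function on `n` lines. -/
def proj : {n : ℕ} → Fin n → Point (wires n)
  | 0, i => i.elim0
  | n + 1, i => Fin.lastCases (motive := fun _ => Point (wires n ⊗ W)) ⟨snd (wires n) W⟩
      (fun j => Point.comap (fst (wires n) W) (proj j)) i

theorem proj_last (n : ℕ) : proj (Fin.last n) = (⟨snd (wires n) W⟩ : Point (wires n ⊗ W)) :=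
  Fin.lastCases_last

theorem proj_castSucc {n : ℕ} (j : Fin n) :
    proj j.castSucc = Point.comap (fst (wires n) W) (proj j) := Fin.lastCases_castSucc j

theorem tap_mk {n : ℕ} (i : Fin n) :
    ((tap i).mk : wires n ⟶ wires n ⊗ W) = pair (𝟙 (wires n)) (proj i).hom := by
  induction n with
  | zero => exact i.elim0
  | succ n ih =>
    induction i using Fin.lastCases with
    | last =>
      rw [proj_last]
      refine Eq.trans ?_ (pair_id_snd (A := wires n) (B := W)).symm
      rw [tap, Fin.lastCases_last]
      exact (Category.comp_id (wires n ◁ Δ[W])).symm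
    | cast j =>
      rw [proj_castSucc]
      refine Eq.trans ?_ (pair_id_fst_comp (B := W) (proj j).hom).symm
      rw [← ih, tap, Fin.lastCases_castSucc]
      have e : (wires n ◁ (β_ W W).hom : (wires n ⊗ W) ⊗ W ⟶ (wires n ⊗ W) ⊗ W) =
          (α_ (wires n) W W).hom ≫ wires n ◁ (β_ W W).hom ≫ (α_ (wires n) W W).inv :=
        ((Category.id_comp (wires n ◁ (β_ W W).hom ≫ (α_ _ W W).inv)).trans
          (Category.comp_id (wires n ◁ (β_ W W).hom))).symm
      exact congrArg (((tap j).mk : wires n ⟶ wires n ⊗ W) ▷ W ≫ ·) e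

/-- The values of the lines in a list, the head of the list being the last entry. -/
def tuple {n : ℕ} : (l : List (Fin n)) → (wires n ⟶ wires l.length)
  | [] => ε[wires n]
  | i :: l => pair (tuple l) (proj i).hom

theorem taps_mk {n : ℕ} (l : List (Fin n)) :
    ((taps l).mk : wires n ⟶ wires n ⊗ wires l.length) = pair (𝟙 (wires n)) (tuple l) := by
  induction l with
  | nil =>
    refine Eq.trans ?_ (Category.comp_id (pair (𝟙 (wires n)) ε[wires n]))
    exact (pair_counit (𝟙 (wires n))).symm
  | cons i l ih =>
    refine Eq.trans ?_ (pair_associator (𝟙 (wires n)) (tuple l) (proj i).hom)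
    refine Eq.trans ?_ (Category.comp_id (pair (pair (𝟙 (wires n)) (tuple l)) (proj i).hom)).symm
    rw [← Category.id_comp (pair (𝟙 (wires n)) (tuple l)), ← pair_whiskerRight, ← ih, ← tap_mk]
    rfl

/-- A gate attached to some lines is the box of the effect that reads the values of these lines. -/
theorem attach_mk {n : ℕ} (l : List (Fin n)) (E : ZX l.length 0) :
    (attach l E).mk = Effect.box (⟨tuple l ≫ E.mk⟩ : Effect (wires n)) := by
  rw [Effect.box]
  refine Eq.trans ?_ (congrArg (· ≫ (ρ_ (wires n)).hom)
    (pair_whiskerLeft (𝟙 (wires n)) (tuple l) (E.mk : wires l.length ⟶ 𝟙_ Wires)))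
  rw [← taps_mk]
  exact (Category.comp_id _).symm

theorem spider_succ_mk (c : Color) (n : ℕ) :
    (spider c 0 (n + 1) 1).mk = ((spider c 0 n 1).mk ▷ W : wires n ⊗ W ⟶ W ⊗ W) ≫ mul c := by
  refine (fuse c (add_zero 0) n 0 0 1 1).symm.trans ?_
  exact congrArg₂ (· ≫ ·) (Category.comp_id ((spider c 0 n 1).mk ▷ W : wires n ⊗ W ⟶ W ⊗ W))
    (empty_tensor_mk_two_one (spider c 0 2 1))

theorem tuple_xor {n : ℕ} (l : List (Fin n)) :
    tuple l ≫ (X 0 l.length 1).mk = ((l.map proj).sum : Point (wires n)).hom := by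
  induction l with
  | nil => rfl
  | cons i l ih =>
    rw [List.map_cons, List.sum_cons, add_comm, Point.add_hom, ← ih]
    refine (congrArg (tuple (i :: l) ≫ ·) (spider_succ_mk .red l.length)).trans ?_
    refine (Category.assoc _ _ _).symm.trans ?_
    exact congrArg (· ≫ mul .red) (pair_whiskerRight _ _ _)

/-- The `n`-input AND gate without its final inverse triangle. -/
def triMul (n : ℕ) : wires n ⟶ W := (power triangle n).mk ≫ (Z 0 n 1).mk

theorem triMul_succ (n : ℕ) :
    triMul (n + 1) = (triMul n ⊗ₘ tri : wires n ⊗ W ⟶ W ⊗ W) ≫ mul .green := by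
  refine (congrArg ((power triangle (n + 1)).mk ≫ ·) (spider_succ_mk .green n)).trans ?_
  refine (Category.assoc _ _ _).symm.trans ?_
  refine congrArg (· ≫ mul .green) ?_
  refine (congrArg (((power triangle n).mk ⊗ₘ tri : wires n ⊗ W ⟶ wires n ⊗ W) ≫ ·)
    (tensorHom_id _ _).symm).trans ?_
  exact (tensorHom_comp_tensorHom _ _ _ _).trans (congrArg (triMul n ⊗ₘ ·) (Category.comp_id tri))

theorem tuple_triMul {n : ℕ} (l : List (Fin n)) :
    tuple l ≫ triMul l.length = ((l.map proj).prod : Point (wires n)).hom ≫ tri := by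
  induction l with
  | nil =>
    rw [List.map_nil, List.prod_nil, Point.one_hom, Category.assoc, state_pi_tri]
    exact congrArg (ε[wires n] ≫ ·) (Category.id_comp _)
  | cons i l ih =>
    rw [List.map_cons, List.prod_cons, mul_comm, Point.mul_hom, Point.conv_and, Category.assoc,
      triInv_tri, Category.comp_id, ← ih]
    refine (congrArg (tuple (i :: l) ≫ ·) (triMul_succ l.length)).trans ?_
    refine (Category.assoc _ _ _).symm.trans ?_
    exact congrArg (· ≫ mul .green) (pair_map _ _ _ _)

theorem tuple_and {n : ℕ} (l : List (Fin n)) :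
    tuple l ≫ (andGate l.length).mk = ((l.map proj).prod : Point (wires n)).hom := by
  have h : (andGate l.length).mk = triMul l.length ≫ triInv :=
    congrArg (triMul l.length ≫ ·) triangleInv_mk
  refine (congrArg (tuple l ≫ ·) h).trans ?_
  refine (Category.assoc (tuple l) (triMul l.length) triInv).symm.trans ?_
  rw [tuple_triMul, Category.assoc, tri_triInv, Category.comp_id]

theorem phaseGadget_mk (n : ℕ) (θ : Real.Angle) :
    (phaseGadget n θ).mk = ((∑ i, proj i : Point (wires n)).kick θ).box := by
  rw [phaseGadget, attach_mk, Fin.sum_univ_def, Point.kick, ← tuple_xor]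
  exact congrArg (fun f => Effect.box ⟨f⟩) (Category.assoc (tuple (List.finRange n))
    ((X 0 (List.finRange n).length 1).mk : _ ⟶ W) (effect .green θ)).symm

theorem andPhase_mk {n : ℕ} (S : Finset (Fin n)) (θ : Real.Angle) :
    (andPhase S θ).mk = ((∏ i ∈ S, proj i : Point (wires n)).kick θ).box := by
  have h : ∏ i ∈ S, proj i = ((S.sort (· ≤ ·)).map proj).prod := by
    rw [← List.prod_toFinset _ (S.sort_nodup _), Finset.sort_toFinset]
  rw [andPhase, attach_mk, h, Point.kick, ← tuple_and]
  exact congrArg (fun f => Effect.box ⟨f⟩) (Category.assoc (tuple (S.sort (· ≤ ·)))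
    ((andGate (S.sort (· ≤ ·)).length).mk : _ ⟶ W) (effect .green θ)).symm

theorem phase_eq_box (θ : Real.Angle) :
    phase .green θ = Effect.box (⟨effect .green θ⟩ : Effect W) := by
  rw [Effect.box, ← Category.id_comp (effect .green θ), ← pair_whiskerLeft, pair_id_id]
  change _ = (comul .green ≫ _) ≫ _
  rw [comul_effect, Category.assoc, Iso.inv_hom_id, Category.comp_id]

theorem linePhases_mk (n : ℕ) (θ : Real.Angle) :
    (linePhases n θ).mk = (∏ i, (proj i : Point (wires n)).kick θ).box := by
  induction n with
  | zero => exact (Effect.box_one (A := wires 0)).symm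
  | succ n ih =>
    have h : (linePhases (n + 1) θ).mk = Effect.box (Effect.prod
        (∏ i, (proj i : Point (wires n)).kick θ) (⟨effect .green θ⟩ : Effect W)) := by
      rw [Effect.box_prod, ← ih, ← phase_eq_box]
      rfl
    rw [h, Effect.prod_eq, map_prod, Fin.prod_univ_castSucc, proj_last]
    refine congrArg Effect.box (congrArg₂ (· * ·) (Finset.prod_congr rfl fun j _ => ?_) rfl)
    rw [proj_castSucc]
    exact (Point.kick_comap _ _ _).symm

theorem seqList_mk {n : ℕ} {ι : Type*} (L : List ι) (f : ι → ZX n n) (e : ι → Effect (wires n))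
    (h : ∀ i, (f i).mk = (e i).box) : (seqList (L.map f)).mk = ((L.map e).prod).box := by
  induction L with
  | nil => exact (Effect.box_one (A := wires n)).symm
  | cons i L ih => rw [List.map_cons, List.map_cons, List.prod_cons, Effect.box_mul, ← ih, ← h]; rfl

section

/-- The empty tuple. -/
def discard (A : Wires) [ComonObj A] : A ⟶ wires 0 := ε[A]

attribute [local instance] ComonObj.instTensorUnit in
instance (A : Wires) [ComonObj A] : IsComonHom (discard A) :=
  inferInstanceAs (IsComonHom (ε[A] : A ⟶ 𝟙_ Wires))

variable {A : Wires} [ComonObj A] [IsCommComonObj A]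

/-- Extend a tuple of values by another value. -/
def extend {n : ℕ} (d : A ⟶ wires n) (f : Point A) : A ⟶ wires (n + 1) :=
  (pair d f.hom : A ⟶ wires n ⊗ W)

instance {n : ℕ} (d : A ⟶ wires n) [IsComonHom d] (f : Point A) : IsComonHom (extend d f) :=
  inferInstanceAs (IsComonHom (pair d f.hom))

theorem comap_extend_last {n : ℕ} (d : A ⟶ wires n) [IsComonHom d] (f : Point A) :
    Point.comap (extend d f) (proj (Fin.last n)) = f := by
  rw [proj_last]
  exact Point.ext (pair_snd d f.hom)

theorem comap_extend_castSucc {n : ℕ} (d : A ⟶ wires n) [IsComonHom d] (f : Point A) (j : Fin n) :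
    Point.comap (extend d f) (proj j.castSucc) = Point.comap d (proj j) := by
  rw [proj_castSucc]
  refine Point.ext ?_
  refine (Category.assoc _ _ _).symm.trans ?_
  exact congrArg (· ≫ (proj j).hom) (pair_fst d f.hom)

/-- The phase of an XOR of two functions: the three-line gadget rule with one line set to `0`. -/
theorem kick_two_of_nonneg (α : ℝ) (h0 : 0 ≤ α) (h1 : α < 2 * Real.pi) (f g : Point A) :
    f.kick ((α / 2 : ℝ) : Real.Angle) * g.kick ((α / 2 : ℝ) : Real.Angle) *
      (f + g).kick ((-α / 2 : ℝ) : Real.Angle) = (f * g).kick (α : Real.Angle) := by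
  have h := mk_eq_mk.2 (Derivable.smallGadget α h0 h1)
  simp only [mk_seq, andPhase_mk, linePhases_mk, phaseGadget_mk, ← Effect.box_mul] at h
  let d : A ⟶ wires 3 := extend (extend (extend (discard A) f) g) 0
  have p0 : Point.comap d (proj 0) = f := by
    refine (comap_extend_castSucc _ _ 0).trans ((comap_extend_castSucc _ _ 0).trans ?_)
    exact comap_extend_last _ _
  have p1 : Point.comap d (proj 1) = g := by
    refine (comap_extend_castSucc _ _ 1).trans ?_
    exact comap_extend_last _ _
  have p2 : Point.comap d (proj 2) = 0 := comap_extend_last _ _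
  have h' := congrArg (Effect.comap d) (Effect.box_injective h)
  simpa [← Point.kick_comap, p0, p1, p2, Fin.prod_univ_three, Fin.sum_univ_three,
    Point.kick_zero] using h'

theorem kick_two (α : ℝ) (f g : Point A) :
    f.kick ((α / 2 : ℝ) : Real.Angle) * g.kick ((α / 2 : ℝ) : Real.Angle) *
      (f + g).kick ((-α / 2 : ℝ) : Real.Angle) = (f * g).kick (α : Real.Angle) := by
  set β := toIcoMod Real.two_pi_pos 0 α
  have hβ := toIcoMod_mem_Ico' Real.two_pi_pos α
  have hα : (α : Real.Angle) = (β : Real.Angle) := (Real.Angle.coe_toIcoMod α 0).symm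
  -- halving an angle is well defined only up to `ψ`, which is `0` or `π`
  set ψ : Real.Angle := ((α / 2 : ℝ) : Real.Angle) - ((β / 2 : ℝ) : Real.Angle) with hψ
  have h2 : (2 : ℕ) • ψ = 0 := by
    rw [hψ, nsmul_sub, two_nsmul, two_nsmul, ← Real.Angle.coe_add, ← Real.Angle.coe_add, add_halves,
      add_halves, hα, sub_self]
  have e1 : ((α / 2 : ℝ) : Real.Angle) = ((β / 2 : ℝ) : Real.Angle) + ψ := by rw [hψ]; abel
  have e2 : ((-α / 2 : ℝ) : Real.Angle) = ((-β / 2 : ℝ) : Real.Angle) + ψ := by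
    rw [neg_div, neg_div, Real.Angle.coe_neg, Real.Angle.coe_neg, e1]
    rw [two_nsmul] at h2
    rw [neg_add, ← eq_neg_of_add_eq_zero_left h2]
  have key : f.kick ψ * g.kick ψ * (f + g).kick ψ = 1 := by
    rcases Real.Angle.two_nsmul_eq_zero_iff.1 h2 with h | h
    · simp [h, Point.kick_angle_zero]
    · rw [h, Point.kick_add_pi, mul_mul_mul_comm, Point.kick_pi_sq, Point.kick_pi_sq, one_mul]
  rw [hα, ← kick_two_of_nonneg β hβ.1 hβ.2, e1, e2, Point.kick_add, Point.kick_add, Point.kick_add,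
    mul_mul_mul_comm (f.kick _), mul_mul_mul_comm, key, mul_one]

end

end ZXCalc

end

theorem theorem1 (α : ℝ) (n : ℕ) (hn : 2 ≤ n) (L : List (Finset (Fin n))) (hL : L.Nodup)
    (hmem : ∀ S : Finset (Fin n), S ∈ L ↔ 2 ≤ S.card) :
    ZXCalc.Derivable
      (ZXCalc.ZX.seq (ZXCalc.ZX.linePhases n ((α / 2 : ℝ) : Real.Angle))
        (ZXCalc.ZX.phaseGadget n ((-α / 2 : ℝ) : Real.Angle)))
      (ZXCalc.ZX.seqList (L.map fun S =>
        ZXCalc.ZX.andPhase S (((-1) ^ S.card * 2 ^ (S.card - 2) * α : ℝ) : Real.Angle))) := by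
  open ZXCalc in
  rw [← ZX.mk_eq_mk, ZX.mk_seq, linePhases_mk, phaseGadget_mk, ← Effect.box_mul,
    Point.kick_sum kick_two, seqList_mk L _ _ fun S => andPhase_mk S _,
    ← List.prod_toFinset _ hL]
  congr 2
  ext S
  simp [hmem]
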